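/- Let $\mathbb H$ be the space of (complex-valued) fields $u=\sum_{j\in\mathbb Z^2\setminus\{0\}}\hat u_je^{ij\cdot x}\in (L^2(\mathbb T^2))^2$ on $\mathbb T^2=[0,2\pi]^2$ (periodic) with $\int_{\mathbb T^2}u\,dx=0$ and $\nabla\cdot u=0$. Let $A=-\Delta$ on $\mathbb H$, with eigenvalues $\lambda_1\le\lambda_2\le\cdots$ (the numbers $j_1^2+j_2^2$, $j\in\mathbb Z^2\setminus\{0\}$, repeated according to multiplicity) and a corresponding complete orthonormal system of eigenvectors $(e_n)_{n\ge1}$. For $0<k<\lambda_N$ put $$\mathcal I_{k,N}u=\sum_{\lambda_N-k\le\lambda_n\le\lambda_N+k}(u,e_n)\,e_n .$$ Let $P_\sigma g=\sum_{j\ne0}P_j\hat g_je^{ij\cdot x}$ be the Helmholtz–Leray projection of $(L^2(\mathbb T^2))^2$ onto $\mathbb H$, where $P_j=|j|^{-2}\begin{pmatrix}j_2^2&-j_1j_2\\-j_1j_2&j_1^2\end{pmatrix}$, and let $B(u,v)=P_\sigma((u\cdot\nabla)v)$. For every $s\in(0,\frac16)$ there is a constant $c>0$ such that the following holds. Let $\frac{17}{12}<\beta<\frac32$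 with $3-2\beta<s$, let $\epsilon=2\beta-\frac{17}6$, let $\rho>0$, and let $\theta\in C_0^\infty(\mathbb C)$ (smooth in the real sense) satisfy $\theta(\xi)=\xi$ for $|\xi|\le1$ and $|\theta|\le2$ everywhere. Put $\vec\theta(\xi_1,\xi_2)=(\theta(\xi_1),\theta(\xi_2))$ and, for $u\in\mathbb H$, $$W(u)=\sum_{j\in\mathbb Z^2\setminus\{0\}}\frac{\rho}{|j|^{3+\epsilon}}P_j\vec\theta\Big(\frac{|j|^{3+\epsilon}\hat u_j}{\rho}\Big)e^{ij\cdot x},\qquad \mathscr F(u)=A^{-1/2}B(W(u),W(u)).$$ Then $\mathscr F:\mathbb H\to\mathbb H$ has at every $u\in\mathbb H$ a Gateaux derivative $\mathscr F'(u)$, a bounded real-linear operator on $\mathbb H$, and there exist arbitrarily large $\lambda_N$ and $k$ with $c\lambda_N^s\le k<\lambda_N$ such that $$\|\mathcal I_{k,N}\,\mathscr F'(u)\,\mathcal I_{k,N}\|_{\mathcal L(\mathbb H,\mathbb H)}\le\frac1{16}\lambda_N^{-\frac12(3-2\beta)}\qquad\text{for every }u\in\mathbb H .$$ -/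

import Mathlib

open MeasureTheory
open scoped ContDiff

noncomputable section

namespace HNSE

/-! ### The periodic domain and its Fourier series

The torus `ℝ² / 2πℤ²` with coordinate `x` is parametrized by `y ∈ (ℝ / ℤ)²` through `x = 2π y`, and
carries the normalized measure `dy = dx / (4π²)`. Hence `UnitAddTorus.mFourier j` is the character
`e^{i j·x}`, the coefficients of `φ = ∑ φ̂_j e^{i j·x}` are `φ̂_j = (4π²)⁻¹ ∫ φ e^{-i j·x} dx`, and
derivatives below are always taken with respect to `x`. -/

/-- The two-dimensional torus. -/
abbrev Torus : Type := UnitAddTorus (Fin 2)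

/-- The normalized Lebesgue (Haar) measure on the torus. -/
abbrev torusMeasure : Measure Torus := Measure.pi fun _ => AddCircle.haarAddCircle

/-- Complex-valued square integrable functions on the torus. -/
abbrev L2 : Type := Lp ℂ 2 torusMeasure

/-- Vector fields in `(L²(𝕋²))²`, with the norm `(‖u₁‖² + ‖u₂‖²)^{1/2}`. -/
abbrev L2Field : Type := PiLp 2 fun _ : Fin 2 => L2

/-- The frequency lattice `ℤ²`. -/
abbrev Lattice : Type := Fin 2 → ℤ

/-- The Fourier coefficient `φ̂_j` of a function on the torus. -/
def coeff (φ : Torus → ℂ) (j : Lattice) : ℂ := ∫ y, UnitAddTorus.mFourier (-j) y * φ y ∂torusMeasure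

/-- The character `e^{i j·x}` as an element of `L²`. -/
def char (j : Lattice) : L2 := ContinuousMap.toLp (E := ℂ) 2 torusMeasure ℂ (UnitAddTorus.mFourier j)

/-- The Euclidean length `|j|`. -/
def len (j : Lattice) : ℝ := Real.sqrt ((j 0 : ℝ) ^ 2 + (j 1 : ℝ) ^ 2)

/-- The (weak) partial derivative `∂φ/∂x_m = ∑_j i j_m φ̂_j e^{i j·x}`, for `φ` in `H¹`. -/
def partialDeriv (m : Fin 2) (φ : L2) : L2 :=
  ∑' j : Lattice, (Complex.I * (j m : ℂ) * coeff φ j) • char j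

/-! ### The phase space -/

lemma integrable_mul (j : Lattice) (φ : L2) :
    Integrable (fun y => UnitAddTorus.mFourier (-j) y * φ y) torusMeasure := by
  have h : Integrable (φ : Torus → ℂ) torusMeasure := (Lp.memLp φ).integrable (by norm_num)
  refine h.bdd_mul (c := 1)
    (UnitAddTorus.mFourier (-j)).continuous.aestronglyMeasurable
    (Filter.Eventually.of_forall fun y => ?_)
  exact (ContinuousMap.norm_coe_le_norm _ y).trans UnitAddTorus.mFourier_norm.le

lemma coeff_add (j : Lattice) (φ ψ : L2) :
    coeff (φ + ψ : L2) j = coeff φ j + coeff ψ j := by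
  unfold coeff
  rw [← integral_add (integrable_mul j φ) (integrable_mul j ψ)]
  refine integral_congr_ae ?_
  filter_upwards [Lp.coeFn_add φ ψ] with y hy
  rw [hy, Pi.add_apply, mul_add]

lemma coeff_smul (j : Lattice) (c : ℂ) (φ : L2) :
    coeff (c • φ : L2) j = c * coeff φ j := by
  unfold coeff
  rw [← integral_const_mul]
  refine integral_congr_ae ?_
  filter_upwards [Lp.coeFn_smul c φ] with y hy
  rw [hy, Pi.smul_apply, smul_eq_mul]
  ring

lemma coeff_zero (j : Lattice) : coeff (0 : L2) j = 0 := by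
  simpa using coeff_smul j 0 0

lemma coeff_char (j l : Lattice) : coeff (char l) j = if j = l then 1 else 0 := by
  have h := orthonormal_iff_ite.mp (UnitAddTorus.orthonormal_mFourier (d := Fin 2)) j l
  rw [← h]
  simp only [ContinuousMap.inner_toLp, ← UnitAddTorus.mFourier_neg]
  unfold coeff
  refine integral_congr_ae ?_
  filter_upwards [ContinuousMap.coeFn_toLp (𝕜 := ℂ) (p := 2) torusMeasure
    (UnitAddTorus.mFourier l)] with y hy
  rw [char, hy]
  ring

/-- The phase space `ℍ` of square integrable vector fields on the torus with `∫ u = 0`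
(i.e. `û_0 = 0`) and `∇ · u = 0` in the sense of distributions (i.e. `j · û_j = 0` for all `j`). -/
def phaseSpace : Submodule ℂ L2Field where
  carrier := {u | (∀ n, ∫ y, u n y ∂torusMeasure = 0) ∧
    ∀ j : Lattice, ∑ m, (j m : ℂ) * coeff (u m) j = 0}
  zero_mem' := by
    refine ⟨fun n => ?_, fun j => ?_⟩
    · exact (integral_congr_ae (Lp.coeFn_zero ℂ 2 torusMeasure)).trans (by simp)
    · exact Finset.sum_eq_zero fun m _ => by rw [PiLp.zero_apply, coeff_zero, mul_zero]
  add_mem' := by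
    rintro u v ⟨hu, hu'⟩ ⟨hv, hv'⟩
    refine ⟨fun n => ?_, fun j => ?_⟩
    · have h1 := (Lp.memLp (u n)).integrable (by norm_num)
      have h2 := (Lp.memLp (v n)).integrable (by norm_num)
      rw [PiLp.add_apply, integral_congr_ae (Lp.coeFn_add (u n) (v n))]
      simp only [Pi.add_apply]
      rw [integral_add h1 h2, hu, hv, add_zero]
    · simp only [PiLp.add_apply, coeff_add, mul_add, Finset.sum_add_distrib, hu' j, hv' j, add_zero]
  smul_mem' := by
    rintro c u ⟨hu, hu'⟩
    refine ⟨fun n => ?_, fun j => ?_⟩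
    · rw [PiLp.smul_apply, integral_congr_ae (Lp.coeFn_smul c (u n))]
      simp only [Pi.smul_apply]
      rw [integral_smul, hu, smul_zero]
    · simp only [PiLp.smul_apply, coeff_smul, mul_left_comm _ c, ← Finset.mul_sum, hu' j, mul_zero]

/-- The phase space as a type. -/
abbrev H : Type := phaseSpace

/-- The vector Fourier coefficient `û_j ∈ ℂ²` of a field `u ∈ ℍ`. -/
def fieldCoeff (u : H) (j : Lattice) : Fin 2 → ℂ := fun n => coeff (u.1 n) j

/-- The matrix `P_j = |j|⁻² (j₂², -j₁j₂; -j₁j₂, j₁²)` of the Helmholtz–Leray projector. -/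
def lerayMatrix (j : Lattice) : Matrix (Fin 2) (Fin 2) ℂ :=
  ((len j : ℂ) ^ 2)⁻¹ •
    !![(j 1 : ℂ) ^ 2, -((j 0 : ℂ) * (j 1 : ℂ)); -((j 0 : ℂ) * (j 1 : ℂ)), (j 0 : ℂ) ^ 2]

lemma lerayMatrix_zero : lerayMatrix 0 = 0 := by
  ext a b
  fin_cases a <;> fin_cases b <;> simp [lerayMatrix]

lemma lerayMatrix_solenoidal (j : Lattice) (c : Fin 2 → ℂ) :
    ∑ m, (j m : ℂ) * (lerayMatrix j).mulVec c m = 0 := by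
  simp [lerayMatrix, Matrix.mulVec, dotProduct, Fin.sum_univ_two]
  ring

lemma mode_mem (j : Lattice) (c : Fin 2 → ℂ) :
    (WithLp.toLp 2 fun n => (lerayMatrix j).mulVec c n • char j : L2Field) ∈ phaseSpace := by
  refine ⟨fun n => ?_, fun l => ?_⟩
  · have h0 : ∀ φ : L2, ∫ y, φ y ∂torusMeasure = coeff φ 0 := fun φ => by
      simp [coeff, UnitAddTorus.mFourier_zero]
    rw [h0, coeff_smul, coeff_char]
    split_ifs with h
    · subst h
      simp [lerayMatrix_zero]
    · simp
  · simp only [coeff_smul, coeff_char]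
    split_ifs with h
    · subst h
      simpa using lerayMatrix_solenoidal l c
    · simp

/-- The field `(P_j c) e^{i j·x} ∈ ℍ`, for `c ∈ ℂ²`. -/
def mode (j : Lattice) (c : Fin 2 → ℂ) : H :=
  ⟨WithLp.toLp 2 fun n => (lerayMatrix j).mulVec c n • char j, mode_mem j c⟩

/-- The Helmholtz–Leray projection `P_σ g = ∑_{j ≠ 0} P_j ĝ_j e^{i j·x}` of a square integrable
vector field `g` on the torus, given by its components. -/
def leray (g : Fin 2 → Torus → ℂ) : H :=
  ∑' j : {j : Lattice // j ≠ 0}, mode j fun n => coeff (g n) j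

/-! ### The operator `A = -Δ` on `ℍ` -/

/-- The unit eigenvector `e_j = |j|⁻¹ (-j₂, j₁) e^{i j·x}` of `A`, with eigenvalue `|j|²`, `j ≠ 0`
(note `P_j (-j₂, j₁) = (-j₂, j₁)`). These form a complete orthonormal system of `ℍ`. -/
def eigenvector (j : Lattice) : H :=
  mode j ((len j : ℂ)⁻¹ • ![-(j 1 : ℂ), (j 0 : ℂ)])

/-- The `n`-th eigenvalue `λ_n` (`n ≥ 1`) of `A`: the numbers `|j|²`, `j ∈ ℤ² ∖ {0}`, sorted
increasingly and repeated according to multiplicity, i.e. the least `m` such that at least `n` of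
the lattice points `j ≠ 0` satisfy `|j|² ≤ m`. -/
def eigenvalue (n : ℕ) : ℕ :=
  sInf {m : ℕ | n ≤ {j : Lattice | j ≠ 0 ∧ j 0 ^ 2 + j 1 ^ 2 ≤ (m : ℤ)}.ncard}

/-- The operator `A^{-1/2} u = ∑_{j ≠ 0} |j|⁻¹ (u, e_j) e_j`. -/
def invSqrtA (u : H) : H :=
  ∑' j : {j : Lattice // j ≠ 0},
    (((len (j : Lattice))⁻¹ : ℝ) : ℂ) • inner ℂ (eigenvector j) u • eigenvector j

lemma finite_window (a b : ℝ) : {j : Lattice | j ≠ 0 ∧ a ≤ len j ^ 2 ∧ len j ^ 2 ≤ b}.Finite := by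
  refine (Set.finite_Icc (fun _ => -⌈b⌉ : Lattice) (fun _ => ⌈b⌉)).subset ?_
  rintro j ⟨-, -, h⟩
  rw [len, Real.sq_sqrt (by positivity)] at h
  have h' : j 0 ^ 2 + j 1 ^ 2 ≤ ⌈b⌉ := by
    have := h.trans (Int.le_ceil b)
    exact_mod_cast this
  have key : ∀ i, -⌈b⌉ ≤ j i ∧ j i ≤ ⌈b⌉ := by
    intro i
    have hi : j i ^ 2 ≤ ⌈b⌉ := by
      fin_cases i
      · exact (le_add_of_nonneg_right (sq_nonneg _)).trans h'
      · exact (le_add_of_nonneg_left (sq_nonneg _)).trans h'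
    constructor
    · nlinarith [Int.le_self_sq (-(j i))]
    · exact (Int.le_self_sq (j i)).trans hi
  exact ⟨fun i => (key i).1, fun i => (key i).2⟩

/-- The spectral projection `u ↦ ∑ (u, e_j) e_j` onto the eigenvectors of `A` whose eigenvalue lies
in `[a, b]`. -/
def spectralProj (a b : ℝ) : H →L[ℂ] H :=
  ∑ j ∈ (finite_window a b).toFinset,
    (innerSL ℂ (eigenvector j)).smulRight (eigenvector j)

/-- The projection `I_{k,N}` onto the intermediate modes `λ_N - k ≤ λ_j ≤ λ_N + k`, regarded as a
real-linear operator. -/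
def midProj (k : ℝ) (N : ℕ) : H →L[ℝ] H :=
  (spectralProj (eigenvalue N - k) (eigenvalue N + k)).restrictScalars ℝ

/-! ### The prepared nonlinearity -/

/-- `B(u, v) = P_σ ((u · ∇) v)`, where `((u · ∇) v)_n = ∑_m u_m ∂v_n/∂x_m`. -/
def bilinB (u v : H) : H :=
  leray fun n y => ∑ m, u.1 m y * partialDeriv m (v.1 n) y

/-- A cut-off function `θ ∈ C₀^∞(ℂ)` with `θ(ξ) = ξ` for `|ξ| ≤ 1` and `|θ| ≤ 2`; smoothness is in
the real sense. -/
structure IsCutoff (θ : ℂ → ℂ) : Prop where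
  smooth : ContDiff ℝ ∞ θ
  hasCompactSupport : HasCompactSupport θ
  eq_self : ∀ ξ, ‖ξ‖ ≤ 1 → θ ξ = ξ
  norm_le : ∀ ξ, ‖θ ξ‖ ≤ 2

/-- The truncation `W(u) = ∑_{j ≠ 0} ρ |j|^{-(3+ε)} P_j θ⃗(|j|^{3+ε} û_j / ρ) e^{i j·x}`, with `θ`
applied to both components. -/
def truncW (ε ρ : ℝ) (θ : ℂ → ℂ) (u : H) : H :=
  ∑' j : {j : Lattice // j ≠ 0}, mode j fun n =>
    ((ρ / len (j : Lattice) ^ (3 + ε) : ℝ) : ℂ) *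
      θ (((len (j : Lattice) ^ (3 + ε) : ℝ) : ℂ) * fieldCoeff u j n / (ρ : ℂ))

/-- The nonlinearity `𝓕(u) = A^{-1/2} B(W(u), W(u))` of the prepared equation, with
`ε = 2β - 17/6`. -/
def nonlinearity (β ρ : ℝ) (θ : ℂ → ℂ) (u : H) : H :=
  invSqrtA (bilinB (truncW (2 * β - 17 / 6) ρ θ u) (truncW (2 * β - 17 / 6) ρ θ u))

/-- The bounded real-linear operator `D` is the Gateaux derivative of `F` at `u`. -/
def HasGateauxDerivAt (F : H → H) (D : H →L[ℝ] H) (u : H) : Prop :=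
  ∀ v : H, HasLineDerivAt ℝ F (D v) u v

end HNSE

end

noncomputable section

namespace HNSE

open Filter Topology

/-! In two dimensions the divergence-free condition leaves one complex coordinate per frequency, so
`ℍ` becomes a space of square summable scalar sequences. There `W` acts diagonally through functions
`ψ_j` with `|ψ_j| ≤ 4ρ|j|^{-(3+ε)}` and derivatives bounded uniformly in `j`. The factor `A^{-1/2}`
absorbs the derivative in `B`, so that `𝓕` becomes `∑_l k(j,l) ψ_{j-l}(a_{j-l}) ψ_l(a_l)` with `|k|
≤ 1` (`norm_kernel_le`, `coord_nonlinearity`).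

The Gateaux derivative is a diagonal operator followed by two convolution-type operators with
coefficients `ψ_m(a_m)`. Compressed to a spectral window, these involve only frequencies `m` that
are differences of two points of the window. If distinct points of the window are more than `M`
apart, what remains is a tail of `∑ |m|^{-(3+ε)}`, at most a constant times `1/M`, uniformly in `u`
(`norm_midProj_comp_le`).

It remains to find sparse windows, which is a counting argument (`exists_sparse_annulus`). There are
`4M⁹` candidate centres `x² + y²` with `x ~ M⁶`, `y ~ M³`, pairwise separated by more than twice the
half-width `K`. A candidate fails only if some lattice point `j` near its circle has a neighbour `j
- m`, `0 < |m|_∞ ≤ M`, also near it; there are `O(M⁷(K + M))` such pairs, and each spoils at most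
one centre. Hence a good centre exists once `K` is a small multiple of `M²`. Since `λ ≤ 68M¹²`, a
half-width `λ^s` is allowed for `s < 1/6`, while `1/M` beats `λ^{-(3-2β)/2}` because `6(3-2β) < 1`,
that is `β > 17/12`. -/

/-! ### Fourier coefficients in `L²` -/

lemma inner_char (j : Lattice) (φ : L2) : inner ℂ (char j) φ = coeff φ j := by
  rw [L2.inner_def]
  unfold coeff
  refine integral_congr_ae ?_
  filter_upwards [ContinuousMap.coeFn_toLp (𝕜 := ℂ) (p := 2) torusMeasure
    (UnitAddTorus.mFourier j)] with y hy
  rw [char, hy, UnitAddTorus.mFourier_neg]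
  simp [mul_comm]

lemma hasSum_coeff_smul_char (φ : L2) : HasSum (fun j => coeff φ j • char j) φ :=
  UnitAddTorus.hasSum_mFourier_series_L2 φ

lemma eq_zero_of_coeff {φ : L2} (h : ∀ j, coeff φ j = 0) : φ = 0 := by
  refine (hasSum_coeff_smul_char φ).unique ?_
  simp only [h, zero_smul]
  exact hasSum_zero

lemma norm_char (j : Lattice) : ‖char j‖ = 1 :=
  (UnitAddTorus.orthonormal_mFourier (d := Fin 2)).1 j

lemma HasSum.coeff {ι : Type*} {f : ι → L2} {φ : L2} (h : HasSum f φ) (j : Lattice) :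
    HasSum (fun i => coeff (f i) j) (coeff φ j) := by
  simp only [← inner_char]
  exact (innerSL ℂ (char j)).hasSum h

/-! ### Eigenvectors as an orthonormal basis of the phase space -/

/-- The unit vector `|j|⁻¹ (-j₂, j₁)`. -/
def ehat (j : Lattice) : Fin 2 → ℂ := (len j : ℂ)⁻¹ • ![-(j 1 : ℂ), (j 0 : ℂ)]

lemma len_sq (j : Lattice) : len j ^ 2 = (j 0 : ℝ) ^ 2 + (j 1 : ℝ) ^ 2 :=
  Real.sq_sqrt (by positivity)

lemma len_nonneg (j : Lattice) : 0 ≤ len j := Real.sqrt_nonneg _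

lemma len_zero : len 0 = 0 := by simp [len]

lemma len_pos {j : Lattice} (hj : j ≠ 0) : 0 < len j := by
  refine Real.sqrt_pos.2 ?_
  by_contra! h
  apply hj
  have h0 : (j 0 : ℝ) ^ 2 = 0 := le_antisymm (by nlinarith [sq_nonneg (j 1 : ℝ)]) (sq_nonneg _)
  have h1 : (j 1 : ℝ) ^ 2 = 0 := le_antisymm (by nlinarith [sq_nonneg (j 0 : ℝ)]) (sq_nonneg _)
  ext i
  fin_cases i
  · simpa using h0
  · simpa using h1

lemma len_sq_complex (j : Lattice) : (len j : ℂ) ^ 2 = (j 0 : ℂ) ^ 2 + (j 1 : ℂ) ^ 2 := by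
  exact_mod_cast congrArg (fun x : ℝ => (x : ℂ)) (len_sq j)

lemma len_complex_ne_zero {j : Lattice} (hj : j ≠ 0) : (len j : ℂ) ≠ 0 :=
  Complex.ofReal_ne_zero.2 (len_pos hj).ne'

lemma ehat_zero : ehat 0 = 0 := by simp [ehat, len_zero]

lemma conj_ehat (j : Lattice) (n : Fin 2) : starRingEnd ℂ (ehat j n) = ehat j n := by
  fin_cases n <;> simp [ehat]

lemma ehat_dot_self {j : Lattice} (hj : j ≠ 0) : ∑ n, ehat j n * ehat j n = 1 := by
  have h := len_complex_ne_zero hj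
  have h2 := len_sq_complex j
  simp only [Fin.sum_univ_two, ehat, Pi.smul_apply, smul_eq_mul, Matrix.cons_val_zero,
    Matrix.cons_val_one]
  field_simp
  rw [h2]; ring

lemma ehat_dot_freq (j : Lattice) : ∑ n, ehat j n * (j n : ℂ) = 0 := by
  simp [Fin.sum_univ_two, ehat]
  ring

/-- In the plane the orthogonal complement of `j` is a line, so `P_j` has rank one. -/
lemma lerayMatrix_mulVec (j : Lattice) (c : Fin 2 → ℂ) :
    (lerayMatrix j).mulVec c = (∑ n, ehat j n * c n) • ehat j := by
  rcases eq_or_ne j 0 with rfl | hj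
  · simp [lerayMatrix_zero, ehat_zero]
  have h := len_complex_ne_zero hj
  ext n
  fin_cases n <;>
  · simp [lerayMatrix, Matrix.mulVec, dotProduct, Fin.sum_univ_two, ehat]
    field_simp
    try ring

lemma lerayMatrix_ehat (j : Lattice) : (lerayMatrix j).mulVec (ehat j) = ehat j := by
  rw [lerayMatrix_mulVec]
  rcases eq_or_ne j 0 with rfl | hj
  · simp [ehat_zero]
  · rw [ehat_dot_self hj, one_smul]

lemma eigenvector_apply (j : Lattice) (n : Fin 2) :
    (eigenvector j).1 n = ehat j n • char j := by
  change (lerayMatrix j).mulVec (ehat j) n • char j = _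
  rw [lerayMatrix_ehat]

lemma mode_eq (j : Lattice) (c : Fin 2 → ℂ) :
    mode j c = (∑ n, ehat j n * c n) • eigenvector j := by
  refine Subtype.ext ?_
  ext1 n
  rw [Submodule.coe_smul, PiLp.smul_apply, eigenvector_apply]
  change (lerayMatrix j).mulVec c n • char j = _
  rw [lerayMatrix_mulVec, Pi.smul_apply, smul_smul, smul_eq_mul]

lemma eigenvector_zero : eigenvector 0 = 0 := by
  refine Subtype.ext ?_
  ext1 n
  rw [eigenvector_apply, ehat_zero]
  simp

lemma inner_eigenvector (j : Lattice) (u : H) :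
    inner ℂ (eigenvector j) u = ∑ n, ehat j n * fieldCoeff u j n := by
  rw [Submodule.coe_inner, PiLp.inner_apply]
  refine Finset.sum_congr rfl fun n _ => ?_
  rw [eigenvector_apply, inner_smul_left, inner_char, conj_ehat]
  rfl

/-- For `j ≠ 0`, a vector of `ℂ²` annihilated by `j` is a multiple of `ehat j`; for `j = 0` the mean
vanishes. -/
lemma fieldCoeff_eq (u : H) (j : Lattice) :
    fieldCoeff u j = inner ℂ (eigenvector j) u • ehat j := by
  rw [inner_eigenvector]
  rcases eq_or_ne j 0 with rfl | hj
  · rw [ehat_zero, smul_zero]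
    ext n
    have h := u.2.1 n
    simpa [fieldCoeff, coeff, UnitAddTorus.mFourier_zero] using h
  · have hd : ∑ m, (j m : ℂ) * fieldCoeff u j m = 0 := u.2.2 j
    have h := len_complex_ne_zero hj
    have h2 := len_sq_complex j
    simp only [Fin.sum_univ_two] at hd ⊢
    ext n
    fin_cases n
    · simp [ehat]
      field_simp
      rw [h2]
      linear_combination (j 0 : ℂ) * hd
    · simp [ehat]
      field_simp
      rw [h2]
      linear_combination (j 1 : ℂ) * hd

lemma inner_eigenvector_eigenvector (j l : Lattice) :
    inner ℂ (eigenvector j) (eigenvector l) = if j = l ∧ j ≠ 0 then 1 else 0 := by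
  rw [inner_eigenvector]
  simp only [fieldCoeff, eigenvector_apply, coeff_smul, coeff_char]
  by_cases hjl : j = l
  · subst hjl
    rcases eq_or_ne j 0 with rfl | hj
    · simp [ehat_zero]
    · simp [hj, ehat_dot_self hj]
  · simp [hjl]

lemma ext_inner_eigenvector {u v : H}
    (h : ∀ j, inner ℂ (eigenvector j) u = inner ℂ (eigenvector j) v) : u = v := by
  refine sub_eq_zero.1 (Subtype.ext ?_)
  ext1 n
  refine eq_zero_of_coeff fun j => ?_
  have := congrFun (fieldCoeff_eq (u - v) j) n
  rw [inner_sub_right, h, sub_self, zero_smul] at this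
  exact this

/-- The defining conditions of the phase space are closed, since each Fourier coefficient is
continuous. Completeness is needed for the Hilbert basis and for adjoints. -/
instance : CompleteSpace H := by
  have hc : ∀ (n : Fin 2) (j : Lattice), Continuous fun u : L2Field => coeff (u n) j := by
    intro n j
    simp only [← inner_char]
    fun_prop
  have h0 : ∀ φ : L2, ∫ y, φ y ∂torusMeasure = coeff φ 0 := fun φ => by
    simp [coeff, UnitAddTorus.mFourier_zero]
  have : IsClosed (phaseSpace : Set L2Field) := by
    have : (phaseSpace : Set L2Field) = (⋂ n, {u : L2Field | coeff (u n) 0 = 0}) ∩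
        ⋂ j : Lattice, {u : L2Field | ∑ m, (j m : ℂ) * coeff (u m) j = 0} := by
      ext u
      simp only [Set.mem_inter_iff, Set.mem_iInter, Set.mem_ofPred_eq]
      change ((∀ n, ∫ y, u n y ∂torusMeasure = 0) ∧ _) ↔ _
      simp only [h0]
    rw [this]
    refine (isClosed_iInter fun n => isClosed_eq (hc n 0) continuous_const).inter
      (isClosed_iInter fun j => isClosed_eq ?_ continuous_const)
    exact continuous_finsetSum _ fun m _ => continuous_const.mul (hc m j)
  exact this.completeSpace_coe

lemma orthonormal_eigenvector :
    Orthonormal ℂ fun j : {j : Lattice // j ≠ 0} => eigenvector j := by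
  classical
  rw [orthonormal_iff_ite]
  rintro ⟨j, hj⟩ ⟨l, hl⟩
  rw [inner_eigenvector_eigenvector]
  simp [hj]

/-- The eigenvectors as a Hilbert basis of the phase space. -/
def eigenbasis : HilbertBasis {j : Lattice // j ≠ 0} ℂ H :=
  HilbertBasis.mkOfOrthogonalEqBot orthonormal_eigenvector (by
    rw [Submodule.eq_bot_iff]
    intro u hu
    refine ext_inner_eigenvector fun j => ?_
    rw [inner_zero_right]
    rcases eq_or_ne j 0 with rfl | hj
    · simp [eigenvector_zero]
    · exact (Submodule.mem_orthogonal _ _).1 hu _ (Submodule.subset_span ⟨⟨j, hj⟩, rfl⟩))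

lemma eigenbasis_apply (j : {j : Lattice // j ≠ 0}) : eigenbasis j = eigenvector j := by
  simp [eigenbasis]

/-! ### Coordinates on the phase space -/

/-- Square summable sequences on the frequency lattice. -/
abbrev Seq : Type := lp (fun _ : Lattice => ℂ) 2

lemma Seq.norm_sq (b : Seq) : ‖b‖ ^ 2 = ∑' j, ‖b j‖ ^ 2 := by
  have := lp.norm_rpow_eq_tsum (p := 2) (by norm_num) b
  simpa using this

lemma Seq.summable (b : Seq) : Summable fun j => ‖b j‖ ^ 2 := by
  have := (lp.memℓp b).summable (by norm_num)
  simpa using this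

lemma memSeq {f : Lattice → ℂ} (hf : Summable fun j => ‖f j‖ ^ 2) : Memℓp f 2 :=
  memℓp_gen (by simpa using hf)

lemma hasSum_norm_inner_sq (u : H) :
    HasSum (fun j => ‖inner ℂ (eigenvector j) u‖ ^ 2) (‖u‖ ^ 2) := by
  have h := lp.hasSum_norm (p := 2) (by norm_num) (eigenbasis.repr u)
  simp only [HilbertBasis.repr_apply_apply, eigenbasis_apply, LinearIsometryEquiv.norm_map] at h
  norm_num at h
  refine (hasSum_subtype_iff_of_support_subset (s := {j : Lattice | j ≠ 0})
    (f := fun j => ‖inner ℂ (eigenvector j) u‖ ^ 2) ?_).1 h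
  intro j hj h0
  simp [show j = 0 from h0, eigenvector_zero] at hj

/-- The isometry sending a field to the sequence of its coordinates in the eigenvectors. -/
def coord : H →ₗᵢ[ℂ] Seq where
  toFun u := ⟨fun j => inner ℂ (eigenvector j) u, memSeq (hasSum_norm_inner_sq u).summable⟩
  map_add' u v := by ext j; exact inner_add_right _ _ _
  map_smul' c u := by ext j; exact inner_smul_right _ _ _
  norm_map' u := by
    rw [← sq_eq_sq₀ (norm_nonneg _) (norm_nonneg _), Seq.norm_sq]
    exact (hasSum_norm_inner_sq u).tsum_eq

lemma coord_apply (u : H) (j : Lattice) : coord u j = inner ℂ (eigenvector j) u := rfl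

/-- The field with given coordinates. -/
def ofCoord : Seq →L[ℂ] H := ContinuousLinearMap.adjoint coord.toContinuousLinearMap

/-- The adjoint of an isometry is a left inverse. -/
lemma ofCoord_coord (u : H) : ofCoord (coord u) = u := by
  refine ext_inner_left ℂ fun v => ?_
  rw [ofCoord, ContinuousLinearMap.adjoint_inner_right]
  exact coord.inner_map_map v u

/-- Sequences are indexed by the whole lattice so that shifts are bijections; the price is a
spurious entry at `0`, which `ofCoord` discards. -/
lemma coord_ofCoord (b : Seq) {j : Lattice} (hj : j ≠ 0) : coord (ofCoord b) j = b j := by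
  classical
  rw [coord_apply, ofCoord, ContinuousLinearMap.adjoint_inner_right]
  have : coord.toContinuousLinearMap (eigenvector j) = lp.single 2 j (1 : ℂ) := by
    ext l
    change inner ℂ (eigenvector l) (eigenvector j) = _
    rw [inner_eigenvector_eigenvector, lp.single_apply]
    by_cases h : l = j
    · subst h; simp [hj]
    · simp [h]
  rw [this, lp.inner_single_left]
  simp

lemma norm_eigenvector_le (j : Lattice) : ‖eigenvector j‖ ≤ 1 := by
  have h : ‖eigenvector j‖ ^ 2 ≤ 1 := by
    rw [← inner_self_eq_norm_sq (𝕜 := ℂ), inner_eigenvector_eigenvector]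
    split_ifs <;> simp
  exact (sq_le_one_iff₀ (norm_nonneg _)).1 h

/-- The field `∑_j w_j e_j`. -/
def synth (w : Lattice → ℂ) : H := ∑' j, w j • eigenvector j

lemma summable_synth {w : Lattice → ℂ} (hw : Summable fun j => ‖w j‖) :
    Summable fun j => w j • eigenvector j := by
  refine Summable.of_norm_bounded hw fun j => ?_
  rw [norm_smul]
  exact mul_le_of_le_one_right (norm_nonneg _) (norm_eigenvector_le j)

lemma inner_synth {w : Lattice → ℂ} (hw : Summable fun j => ‖w j‖) (h0 : w 0 = 0) (j : Lattice) :
    inner ℂ (eigenvector j) (synth w) = w j := by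
  have h := (innerSL ℂ (eigenvector j)).hasSum (summable_synth hw).hasSum
  refine h.unique ?_
  refine (hasSum_ite_eq j (w j)).congr_fun fun l => ?_
  refine (inner_smul_right (𝕜 := ℂ) (eigenvector j) (eigenvector l) (w l)).trans ?_
  rw [inner_eigenvector_eigenvector]
  by_cases hl : l = j
  · subst hl
    by_cases h' : l = 0
    · simp [h', h0]
    · simp [h']
  · simp [hl, Ne.symm hl]

lemma tsum_subtype_eq_synth (w : Lattice → ℂ) :
    ∑' j : {j : Lattice // j ≠ 0}, w j • eigenvector j = synth w := by
  refine tsum_subtype_eq_of_support_subset (s := {j : Lattice | j ≠ 0})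
    (f := fun j => w j • eigenvector j) ?_
  intro j hj h0
  exact hj (by simp [show j = 0 from h0, eigenvector_zero])

lemma leray_eq_synth (g : Fin 2 → Torus → ℂ) :
    leray g = synth fun j => ∑ n, ehat j n * coeff (g n) j := by
  rw [← tsum_subtype_eq_synth]
  simp only [leray, mode_eq]

lemma invSqrtA_eq_synth (u : H) :
    invSqrtA u = synth fun j => (((len j)⁻¹ : ℝ) : ℂ) * inner ℂ (eigenvector j) u := by
  rw [← tsum_subtype_eq_synth]
  simp only [invSqrtA, mul_smul]

/-! ### The nonlinearity as a convolution -/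

lemma one_le_len {j : Lattice} (hj : j ≠ 0) : 1 ≤ len j := by
  have h := len_pos hj
  have h2 : (0 : ℝ) < ((j 0 ^ 2 + j 1 ^ 2 : ℤ) : ℝ) := by
    push_cast; rw [← len_sq]; positivity
  have h3 : (1 : ℝ) ≤ ((j 0 ^ 2 + j 1 ^ 2 : ℤ) : ℝ) := by
    exact_mod_cast (Int.cast_pos.1 h2)
  push_cast at h3
  rw [← len_sq] at h3
  exact (one_le_sq_iff₀ h.le).1 h3

lemma inv_len_le_one (j : Lattice) : (len j)⁻¹ ≤ 1 := by
  rcases eq_or_ne j 0 with rfl | hj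
  · simp [len_zero]
  · exact inv_le_one_of_one_le₀ (one_le_len hj)

lemma norm_ehat_dot_le (l : Lattice) (x : Fin 2 → ℝ) :
    ‖∑ m, ehat l m * (x m : ℂ)‖ ≤ Real.sqrt (x 0 ^ 2 + x 1 ^ 2) := by
  rcases eq_or_ne l 0 with rfl | hl
  · simp [ehat_zero, Real.sqrt_nonneg]
  have h : ∑ m, ehat l m * (x m : ℂ) = (((-(l 1) * x 0 + l 0 * x 1) / len l : ℝ) : ℂ) := by
    simp [Fin.sum_univ_two, ehat]
    ring
  rw [h, Complex.norm_real, Real.norm_eq_abs]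
  refine Real.abs_le_sqrt ?_
  have hp := len_pos hl
  rw [div_pow, div_le_iff₀ (by positivity), len_sq]
  nlinarith [sq_nonneg ((l 0 : ℝ) * x 0 + l 1 * x 1)]

lemma norm_ehat_le_one (j : Lattice) (n : Fin 2) : ‖ehat j n‖ ≤ 1 := by
  have := norm_ehat_dot_le j (Pi.single n 1)
  fin_cases n <;> simpa [Fin.sum_univ_two] using this

lemma norm_ehat_dot_freq_le (l j : Lattice) : ‖∑ m, ehat l m * (j m : ℂ)‖ ≤ len j := by
  have := norm_ehat_dot_le l fun m => (j m : ℝ)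
  simpa [len] using this

lemma norm_ehat_dot_ehat_le (j l : Lattice) : ‖∑ n, ehat j n * ehat l n‖ ≤ 1 := by
  rcases eq_or_ne l 0 with rfl | hl
  · simp [ehat_zero]
  have := norm_ehat_dot_le j ![-(l 1 : ℝ) / len l, (l 0 : ℝ) / len l]
  have h1 : (-(l 1 : ℝ) / len l) ^ 2 + ((l 0 : ℝ) / len l) ^ 2 = 1 := by
    have hp := len_pos hl
    field_simp
    rw [len_sq]; ring
  simp only [Matrix.cons_val_zero, Matrix.cons_val_one, h1, Real.sqrt_one] at this
  convert this using 3 with n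
  fin_cases n <;> simp [ehat, div_eq_inv_mul]

/-- Parseval's identity for the pair `conj (e_{-j} φ)`, `χ`: both are in `L²`, although the product
`φ χ` is only integrable. -/
lemma hasSum_coeff_mul (φ χ : L2) (j : Lattice) :
    HasSum (fun l => coeff φ (j - l) * coeff χ l) (coeff (fun y => φ y * χ y) j) := by
  have hm : MemLp (fun y => starRingEnd ℂ (UnitAddTorus.mFourier (-j) y * φ y)) 2
      torusMeasure := by
    have hφ := Lp.memLp φ
    refine hφ.of_le_mul (c := 1) ?_ (Filter.Eventually.of_forall fun y => ?_)
    · refine Continuous.comp_aestronglyMeasurable Complex.continuous_conj ?_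
      exact (UnitAddTorus.mFourier (-j)).continuous.aestronglyMeasurable.mul hφ.1
    · rw [RCLike.norm_conj, norm_mul]
      exact mul_le_mul_of_nonneg_right
        ((ContinuousMap.norm_coe_le_norm _ y).trans UnitAddTorus.mFourier_norm.le) (norm_nonneg _)
  have h := UnitAddTorus.hasSum_prod_mFourierCoeff (hm.toLp _ : L2) χ
  have hf : ∀ l, starRingEnd ℂ (UnitAddTorus.mFourierCoeff (hm.toLp _ : L2) l) =
      coeff φ (j - l) := by
    intro l
    unfold UnitAddTorus.mFourierCoeff coeff
    refine (integral_conj (𝕜 := ℂ) (μ := torusMeasure)).symm.trans ?_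
    refine integral_congr_ae ?_
    filter_upwards [hm.coeFn_toLp] with y hy
    rw [hy, smul_eq_mul, map_mul, Complex.conj_conj, UnitAddTorus.mFourier_neg (n := l),
      Complex.conj_conj, ← mul_assoc, ← UnitAddTorus.mFourier_add]
    congr 3
    abel
  simp only [hf] at h
  refine Eq.mp (congrArg (HasSum _) ?_) h
  unfold coeff
  refine integral_congr_ae ?_
  filter_upwards [hm.coeFn_toLp] with y hy
  rw [hy, Complex.conj_conj, mul_assoc]

/-- The weighted summability makes the series defining `partialDeriv` converge; a divergent `tsum`
would have the default value `0`. -/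
lemma coeff_partialDeriv (m : Fin 2) {φ : L2} (hφ : Summable fun j => len j * ‖coeff φ j‖)
    (l : Lattice) : coeff (partialDeriv m φ) l = Complex.I * (l m : ℂ) * coeff φ l := by
  have hs : Summable fun j : Lattice => (Complex.I * (j m : ℂ) * coeff φ j) • char j := by
    refine Summable.of_norm_bounded hφ fun j => ?_
    rw [norm_smul, norm_char, mul_one, norm_mul, norm_mul, Complex.norm_I, one_mul]
    refine mul_le_mul_of_nonneg_right ?_ (norm_nonneg _)
    rw [Complex.norm_intCast]
    refine Real.abs_le_sqrt ?_
    fin_cases m <;> simp <;> positivity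
  have h := HasSum.coeff hs.hasSum l
  refine h.unique ?_
  refine (hasSum_ite_eq l (Complex.I * (l m : ℂ) * coeff φ l)).congr_fun fun j => ?_
  rw [coeff_smul, coeff_char]
  by_cases hl : j = l
  · subst hl; simp
  · simp [hl, Ne.symm hl]

lemma integrable_mul_mul (φ χ : L2) (j : Lattice) :
    Integrable (fun y => UnitAddTorus.mFourier (-j) y * (φ y * χ y)) torusMeasure := by
  have h : Integrable (fun y => φ y * χ y) torusMeasure :=
    MemLp.integrable_mul (p := 2) (q := 2) (Lp.memLp φ) (Lp.memLp χ)
  refine h.bdd_mul (c := 1)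
    (UnitAddTorus.mFourier (-j)).continuous.aestronglyMeasurable
    (Filter.Eventually.of_forall fun y => ?_)
  exact (ContinuousMap.norm_coe_le_norm _ y).trans UnitAddTorus.mFourier_norm.le

/-- The interaction coefficients of `A^{-1/2} B(u, u)` in the eigenvectors. -/
def kernel (j l : Lattice) : ℂ :=
  (((len j)⁻¹ : ℝ) : ℂ) * (Complex.I * (∑ m, ehat (j - l) m * (l m : ℂ)) *
    ∑ n, ehat j n * ehat l n)

lemma norm_kernel_le (j l : Lattice) : ‖kernel j l‖ ≤ 1 := by
  -- Incompressibility: `ehat (j - l)` is orthogonal to `j - l`, so the derivative can be moved from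
  -- `l` to the output frequency `j`, where `|j|⁻¹` cancels it.
  have h1 : ∑ m, ehat (j - l) m * (l m : ℂ) = ∑ m, ehat (j - l) m * (j m : ℂ) := by
    have := ehat_dot_freq (j - l)
    simp only [Fin.sum_univ_two, Pi.sub_apply, Int.cast_sub] at *
    linear_combination -this
  have h2 := norm_ehat_dot_freq_le (j - l) j
  have h3 := norm_ehat_dot_ehat_le j l
  have h0 := len_nonneg j
  rw [kernel, h1, norm_mul, norm_mul, norm_mul, Complex.norm_I, one_mul, Complex.norm_real,
    Real.norm_eq_abs, abs_of_nonneg (inv_nonneg.2 h0)]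
  calc (len j)⁻¹ * (‖∑ m, ehat (j - l) m * (j m : ℂ)‖ * ‖∑ n, ehat j n * ehat l n‖)
      ≤ (len j)⁻¹ * (len j * 1) := by gcongr
    _ ≤ 1 := by rw [mul_one]; exact inv_mul_le_one

lemma summable_convolution {a b : Lattice → ℝ} (ha : Summable a) (hb : Summable b)
    (ha0 : ∀ j, 0 ≤ a j) (hb0 : ∀ j, 0 ≤ b j) :
    (∀ j, Summable fun l => a (j - l) * b l) ∧ Summable fun j => ∑' l, a (j - l) * b l := by
  have h : Summable fun p : Lattice × Lattice => a (p.1 - p.2) * b p.2 := by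
    let e : Lattice × Lattice ≃ Lattice × Lattice :=
      { toFun := fun p => (p.1 - p.2, p.2)
        invFun := fun p => (p.1 + p.2, p.2)
        left_inv := fun p => by simp
        right_inv := fun p => by simp }
    have h0 : Summable fun p : Lattice × Lattice => a p.1 * b p.2 :=
      ha.mul_of_nonneg hb ha0 hb0
    have h1 := e.summable_iff.2 h0
    exact h1
  exact ⟨fun j => h.prod_factor j, h.prod⟩

/-- The coordinates of `B(u, u)` are dominated by the convolution of two summable sequences, `|w_j|`
and `|j| |w_j|`. They are thus absolutely summable, so the series behind `leray` and `invSqrtA`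
converge and coordinates can be read off. -/
lemma hasSum_inner_invSqrtA_bilinB {u : H}
    (hw : Summable fun j => ‖inner ℂ (eigenvector j) u‖)
    (hw' : Summable fun j => len j * ‖inner ℂ (eigenvector j) u‖) (j : Lattice) :
    HasSum (fun l => kernel j l * inner ℂ (eigenvector (j - l)) u * inner ℂ (eigenvector l) u)
      (inner ℂ (eigenvector j) (invSqrtA (bilinB u u))) := by
  set w : Lattice → ℂ := fun j => inner ℂ (eigenvector j) u with hwdef
  have hc : ∀ (n : Fin 2) l, coeff (u.1 n) l = w l * ehat l n := fun n l =>
    congrFun (fieldCoeff_eq u l) n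
  have hcs : ∀ n : Fin 2, Summable fun l => len l * ‖coeff (u.1 n) l‖ := fun n => by
    refine Summable.of_nonneg_of_le (fun l => mul_nonneg (len_nonneg l) (norm_nonneg _))
      (fun l => ?_) hw'
    rw [hc, norm_mul]
    exact mul_le_mul_of_nonneg_left (mul_le_of_le_one_right (norm_nonneg _) (norm_ehat_le_one l n))
      (len_nonneg l)
  set κ : Lattice → Lattice → ℂ := fun j l =>
    Complex.I * (∑ m, ehat (j - l) m * (l m : ℂ)) * ∑ n, ehat j n * ehat l n with hκ
  set z : Lattice → ℂ := fun j => ∑ n, ehat j n *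
    coeff (fun y => ∑ m, u.1 m y * partialDeriv m (u.1 n) y) j with hz
  have hB : bilinB u u = synth z := leray_eq_synth _
  have hsum : ∀ j, HasSum (fun l => κ j l * w (j - l) * w l) (z j) := by
    intro j
    have h1 : ∀ n : Fin 2, coeff (fun y => ∑ m, u.1 m y * partialDeriv m (u.1 n) y) j =
        ∑ m, coeff (fun y => u.1 m y * partialDeriv m (u.1 n) y) j := by
      intro n
      unfold coeff
      simp only [Finset.mul_sum]
      exact integral_finsetSum _ fun m _ => integrable_mul_mul _ _ j
    have h2 : ∀ n : Fin 2, HasSum (fun l => ∑ m, coeff (u.1 m) (j - l) *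
        (Complex.I * (l m : ℂ) * coeff (u.1 n) l))
        (coeff (fun y => ∑ m, u.1 m y * partialDeriv m (u.1 n) y) j) := by
      intro n
      rw [h1]
      refine hasSum_sum fun m _ => ?_
      simpa only [coeff_partialDeriv m (hcs n)] using
        hasSum_coeff_mul (u.1 m) (partialDeriv m (u.1 n)) j
    have h3 := hasSum_sum fun (n : Fin 2) (_ : n ∈ Finset.univ) => (h2 n).mul_left (ehat j n)
    refine h3.congr_fun fun l => ?_
    simp only [hκ, hc, Fin.sum_univ_two]
    ring
  have hbound : ∀ j l, ‖κ j l * w (j - l) * w l‖ ≤ ‖w (j - l)‖ * (len l * ‖w l‖) := by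
    intro j l
    simp only [hκ, norm_mul, Complex.norm_I, one_mul]
    have e1 := norm_ehat_dot_freq_le (j - l) l
    have e2 := norm_ehat_dot_ehat_le j l
    calc _ ≤ len l * 1 * ‖w (j - l)‖ * ‖w l‖ := by
          gcongr
          exact len_nonneg l
      _ = _ := by ring
  obtain ⟨c1, c2⟩ := summable_convolution hw hw' (fun j => norm_nonneg _)
    (fun j => mul_nonneg (len_nonneg j) (norm_nonneg _))
  have hzs : Summable fun j => ‖z j‖ := by
    refine Summable.of_nonneg_of_le (fun j => norm_nonneg _) (fun j => ?_) c2
    rw [← (hsum j).tsum_eq]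
    exact tsum_of_norm_bounded (c1 j).hasSum (hbound j)
  have hz0 : z 0 = 0 := by simp [hz, ehat_zero]
  have hs : Summable fun j => ‖(((len j)⁻¹ : ℝ) : ℂ) * z j‖ := by
    refine Summable.of_nonneg_of_le (fun j => norm_nonneg _) (fun j => ?_) hzs
    rw [norm_mul, Complex.norm_real, Real.norm_eq_abs,
      abs_of_nonneg (inv_nonneg.2 (len_nonneg j))]
    exact mul_le_of_le_one_left (norm_nonneg _) (inv_len_le_one j)
  rw [invSqrtA_eq_synth, hB]
  simp only [inner_synth hzs hz0]
  rw [inner_synth hs (by simp [hz0])]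
  refine ((hsum j).mul_left (((len j)⁻¹ : ℝ) : ℂ)).congr_fun fun l => ?_
  simp only [hκ, kernel]
  ring

/-! ### Weighted shifts, diagonal operators and convolution-type operators -/

lemma Seq.hasSum_shift (b : Seq) (m : Lattice) :
    HasSum (fun j => ‖b (j - m)‖ ^ 2) (‖b‖ ^ 2) := by
  rw [Seq.norm_sq]
  exact (Equiv.subRight m).hasSum_iff.2 b.summable.hasSum

lemma Seq.summable_of_le_shift {f : Lattice → ℂ} (b : Seq) (m : Lattice) {C : ℝ}
    (h : ∀ j, ‖f j‖ ≤ C * ‖b (j - m)‖) : Summable fun j => ‖f j‖ ^ 2 := by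
  refine Summable.of_nonneg_of_le (fun j => by positivity) (fun j => ?_)
    ((b.hasSum_shift m).summable.mul_left (C ^ 2))
  rw [← mul_pow]
  exact pow_le_pow_left₀ (norm_nonneg _) (h j) 2

lemma Seq.norm_le_of_le_shift {f b : Seq} (m : Lattice) {C : ℝ} (hC : 0 ≤ C)
    (h : ∀ j, ‖f j‖ ≤ C * ‖b (j - m)‖) : ‖f‖ ≤ C * ‖b‖ := by
  rw [← sq_le_sq₀ (norm_nonneg _) (by positivity), mul_pow, Seq.norm_sq]
  refine hasSum_le (fun j => ?_) f.summable.hasSum ((b.hasSum_shift m).mul_left (C ^ 2))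
  rw [← mul_pow]
  exact pow_le_pow_left₀ (norm_nonneg _) (h j) 2

/-- The weighted shift `b ↦ (κ_j b_{j-m})_j`. -/
def shiftOp (κ : Lattice → ℂ) (hκ : ∀ j, ‖κ j‖ ≤ 1) (m : Lattice) : Seq →L[ℂ] Seq :=
  have hle : ∀ (b : Seq) (j : Lattice), ‖κ j * b (j - m)‖ ≤ 1 * ‖b (j - m)‖ := fun b j => by
    rw [norm_mul]
    exact mul_le_mul_of_nonneg_right (hκ j) (norm_nonneg _)
  LinearMap.mkContinuous
    { toFun := fun b => ⟨fun j => κ j * b (j - m), memSeq (b.summable_of_le_shift m (hle b))⟩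
      map_add' := fun b b' => by ext j; exact mul_add _ _ _
      map_smul' := fun c b => by ext j; exact mul_left_comm _ _ _ } 1
    fun b => Seq.norm_le_of_le_shift m zero_le_one (hle b)

lemma shiftOp_apply (κ : Lattice → ℂ) (hκ : ∀ j, ‖κ j‖ ≤ 1) (m : Lattice) (b : Seq)
    (j : Lattice) : shiftOp κ hκ m b j = κ j * b (j - m) := rfl

lemma norm_shiftOp_le (κ : Lattice → ℂ) (hκ : ∀ j, ‖κ j‖ ≤ 1) (m : Lattice) :
    ‖shiftOp κ hκ m‖ ≤ 1 := by
  refine ContinuousLinearMap.opNorm_le_bound _ zero_le_one fun b =>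
    Seq.norm_le_of_le_shift m zero_le_one fun j => ?_
  rw [shiftOp_apply, norm_mul]
  exact mul_le_mul_of_nonneg_right (hκ j) (norm_nonneg _)

/-- The real-linear diagonal operator `b ↦ (A_j b_j)_j`. -/
def diagOp (A : Lattice → ℂ →L[ℝ] ℂ) (C : ℝ) (hC : 0 ≤ C) (hA : ∀ j, ‖A j‖ ≤ C) :
    Seq →L[ℝ] Seq :=
  have hle : ∀ (b : Seq) (j : Lattice), ‖A j (b j)‖ ≤ C * ‖b (j - 0)‖ := fun b j => by
    rw [sub_zero]
    exact (A j).le_of_opNorm_le (hA j) _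
  LinearMap.mkContinuous
    { toFun := fun b => ⟨fun j => A j (b j), memSeq (b.summable_of_le_shift 0 (hle b))⟩
      map_add' := fun b b' => by ext j; exact (A j).map_add _ _
      map_smul' := fun c b => by ext j; exact (A j).map_smul _ _ } C
    fun b => Seq.norm_le_of_le_shift 0 hC (hle b)

lemma diagOp_apply (A : Lattice → ℂ →L[ℝ] ℂ) (C : ℝ) (hC : 0 ≤ C) (hA : ∀ j, ‖A j‖ ≤ C)
    (b : Seq) (j : Lattice) : diagOp A C hC hA b j = A j (b j) := rfl

lemma norm_diagOp_le (A : Lattice → ℂ →L[ℝ] ℂ) (C : ℝ) (hC : 0 ≤ C) (hA : ∀ j, ‖A j‖ ≤ C) :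
    ‖diagOp A C hC hA‖ ≤ C := by
  refine ContinuousLinearMap.opNorm_le_bound _ hC fun b =>
    Seq.norm_le_of_le_shift 0 hC fun j => ?_
  rw [diagOp_apply, sub_zero]
  exact (A j).le_of_opNorm_le (hA j) _

open Classical in
/-- The restriction of a sequence to a set of frequencies. -/
def restrictOp (s : Set Lattice) : Seq →L[ℂ] Seq :=
  shiftOp (fun j => if j ∈ s then 1 else 0) (fun j => by split_ifs <;> simp) 0

open Classical in
lemma restrictOp_apply (s : Set Lattice) (b : Seq) (j : Lattice) :
    restrictOp s b j = if j ∈ s then b j else 0 := by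
  rw [restrictOp, shiftOp_apply, sub_zero]
  split_ifs <;> simp

lemma norm_restrictOp_apply_le (s : Set Lattice) (b : Seq) : ‖restrictOp s b‖ ≤ ‖b‖ := by
  simpa using (restrictOp s).le_of_opNorm_le (norm_shiftOp_le _ _ _) b

/-- The convolution-type operator `b ↦ (∑_l k(j,l) a_{j-l} b_l)_j`. -/
def convOp (k : Lattice → Lattice → ℂ) (hk : ∀ j l, ‖k j l‖ ≤ 1) (a : Lattice → ℂ) :
    Seq →L[ℂ] Seq :=
  ∑' m, a m • shiftOp (fun j => k j (j - m)) (fun j => hk j (j - m)) m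

section convOp

variable {k : Lattice → Lattice → ℂ} {hk : ∀ j l, ‖k j l‖ ≤ 1} {a : Lattice → ℂ}

lemma norm_smul_shiftOp_le (m : Lattice) :
    ‖a m • shiftOp (fun j => k j (j - m)) (fun j => hk j (j - m)) m‖ ≤ ‖a m‖ := by
  rw [norm_smul]
  exact mul_le_of_le_one_right (norm_nonneg _) (norm_shiftOp_le _ _ _)

lemma hasSum_convOp (ha : Summable fun m => ‖a m‖) :
    HasSum (fun m => a m • shiftOp (fun j => k j (j - m)) (fun j => hk j (j - m)) m)
      (convOp k hk a) :=
  (Summable.of_norm_bounded ha norm_smul_shiftOp_le).hasSum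

lemma norm_convOp_le (ha : Summable fun m => ‖a m‖) : ‖convOp k hk a‖ ≤ ∑' m, ‖a m‖ :=
  tsum_of_norm_bounded ha.hasSum fun m => norm_smul_shiftOp_le (hk := hk) m

lemma convOp_sub {a' : Lattice → ℂ} (ha : Summable fun m => ‖a m‖)
    (ha' : Summable fun m => ‖a' m‖) :
    convOp k hk a - convOp k hk a' = convOp k hk fun m => a m - a' m := by
  have h := (hasSum_convOp (k := k) (hk := hk) ha).sub (hasSum_convOp (k := k) (hk := hk) ha')
  rw [← h.tsum_eq]
  simp only [convOp, sub_smul]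

lemma hasSum_convOp_apply (ha : Summable fun m => ‖a m‖) (b : Seq) :
    HasSum (fun m => a m • shiftOp (fun j => k j (j - m)) (fun j => hk j (j - m)) m b)
      (convOp k hk a b) :=
  (hasSum_convOp (k := k) (hk := hk) ha).map
    ({ toFun := fun T => T b
       map_zero' := rfl
       map_add' := fun _ _ => rfl } : (Seq →L[ℂ] Seq) →+ Seq)
    (continuous_eval_const b)

lemma hasSum_convOp_coord (ha : Summable fun m => ‖a m‖) (b : Seq) (j : Lattice) :
    HasSum (fun m => k j (j - m) * a m * b (j - m)) (convOp k hk a b j) := by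
  have h := (lp.evalCLM ℂ (fun _ : Lattice => ℂ) 2 j).hasSum
    (hasSum_convOp_apply (k := k) (hk := hk) ha b)
  refine h.congr_fun fun m => ?_
  change _ = a m * (k j (j - m) * b (j - m))
  ring

lemma hasSum_convOp_coord' (ha : Summable fun m => ‖a m‖) (b : Seq) (j : Lattice) :
    HasSum (fun l => k j l * a (j - l) * b l) (convOp k hk a b j) := by
  refine ((Equiv.subLeft j).hasSum_iff.2 (hasSum_convOp_coord ha b j)).congr_fun fun l => ?_
  simp

/-- The substitution `l ↦ j - l` exchanges the roles of coefficient and argument, so the bilinear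
expression can be read as a bounded operator on either factor. -/
lemma convOp_swap (a b : Seq) (ha : Summable fun m => ‖a m‖) (hb : Summable fun m => ‖b m‖) :
    convOp k hk a b = convOp (fun j l => k j (j - l)) (fun j l => hk j (j - l)) b a := by
  ext j
  refine (hasSum_convOp_coord' ha b j).unique ((hasSum_convOp_coord hb a j).congr_fun fun l => ?_)
  rw [sub_sub_cancel]
  ring

/-- Only the frequencies `m` in the difference set of `s` contribute to the compression of a
convolution-type operator to `s`. -/
lemma norm_restrictOp_convOp_le (ha : Summable fun m => ‖a m‖) {s : Set Lattice} {t : Lattice → ℝ}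
    (ht : Summable t) (ht0 : ∀ m, 0 ≤ t m) (h : ∀ m, ∀ j ∈ s, j - m ∈ s → ‖a m‖ ≤ t m) (b : Seq) :
    ‖restrictOp s (convOp k hk a (restrictOp s b))‖ ≤ (∑' m, t m) * ‖b‖ := by
  have hs := (restrictOp s).hasSum (hasSum_convOp_apply (k := k) (hk := hk) ha (restrictOp s b))
  rw [← hs.tsum_eq]
  refine tsum_of_norm_bounded (ht.hasSum.mul_right ‖b‖) fun m => ?_
  by_cases hm : ∃ j ∈ s, j - m ∈ s
  · obtain ⟨j, hj, hjm⟩ := hm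
    refine (norm_restrictOp_apply_le _ _).trans ?_
    rw [norm_smul]
    refine mul_le_mul (h m j hj hjm) ?_ (norm_nonneg _) (ht0 m)
    refine le_trans ?_ (norm_restrictOp_apply_le s b)
    simpa using (shiftOp _ (fun j => hk j (j - m)) m).le_of_opNorm_le
      (norm_shiftOp_le _ _ _) (restrictOp s b)
  -- If `m` is not a difference of two points of `s`, the shift by `m` carries nothing from `s` into
  -- `s`.
  · have : restrictOp s (a m • shiftOp (fun j => k j (j - m)) (fun j => hk j (j - m)) m
        (restrictOp s b)) = 0 := by
      ext j
      rw [restrictOp_apply]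
      split_ifs with hj
      · change a m * (k j (j - m) * restrictOp s b (j - m)) = 0
        rw [restrictOp_apply, if_neg fun h' => hm ⟨j, hj, h'⟩]
        simp
      · rfl
    rw [this, norm_zero]
    exact mul_nonneg (ht0 m) (norm_nonneg _)

end convOp

/-! ### Gateaux derivative of a quadratic map with summable symbols -/

/-- A family of differentiable functions `ψ_j : ℂ → ℂ` with uniformly bounded derivatives and a
summable majorant. -/
structure IsSymbol (ψ : Lattice → ℂ → ℂ) (ψ' : Lattice → ℂ → ℂ →L[ℝ] ℂ) (g : Lattice → ℝ) (L : ℝ) :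
    Prop where
  hasFDerivAt : ∀ j z, HasFDerivAt (ψ j) (ψ' j z) z
  norm_deriv_le : ∀ j z, ‖ψ' j z‖ ≤ L
  norm_le : ∀ j z, ‖ψ j z‖ ≤ g j
  summable : Summable g

namespace IsSymbol

variable {ψ : Lattice → ℂ → ℂ} {ψ' : Lattice → ℂ → ℂ →L[ℝ] ℂ} {g : Lattice → ℝ} {L : ℝ}

lemma bound_nonneg (h : IsSymbol ψ ψ' g L) : 0 ≤ L :=
  (norm_nonneg _).trans (h.norm_deriv_le 0 0)

lemma summable_norm (h : IsSymbol ψ ψ' g L) (a : Lattice → ℂ) : Summable fun j => ‖ψ j (a j)‖ :=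
  Summable.of_nonneg_of_le (fun _ => norm_nonneg _) (fun j => h.norm_le j _) h.summable

lemma norm_sub_le (h : IsSymbol ψ ψ' g L) (j : Lattice) (x y : ℂ) :
    ‖ψ j x - ψ j y‖ ≤ L * ‖x - y‖ :=
  Convex.norm_image_sub_le_of_norm_hasFDerivWithin_le
    (fun z _ => (h.hasFDerivAt j z).hasFDerivWithinAt) (fun z _ => h.norm_deriv_le j z)
    convex_univ (Set.mem_univ y) (Set.mem_univ x)

/-- The superposition operator `a ↦ (ψ_j(a_j))_j`. -/
def superpos (h : IsSymbol ψ ψ' g L) (a : Seq) : Seq :=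
  ⟨fun j => ψ j (a j), by
    have h1 : Memℓp (fun j => ψ j (a j)) 1 := memℓp_gen (by simpa using h.summable_norm a)
    exact h1.of_exponent_ge (by norm_num)⟩

lemma summable_superpos (h : IsSymbol ψ ψ' g L) (a : Seq) :
    Summable fun j => ‖h.superpos a j‖ := h.summable_norm a

/-- The derivative of the superposition operator. -/
def superposDeriv (h : IsSymbol ψ ψ' g L) (a : Seq) : Seq →L[ℝ] Seq :=
  diagOp (fun j => ψ' j (a j)) L h.bound_nonneg fun j => h.norm_deriv_le j _

/-- The map `a ↦ (∑_l k(j,l) ψ_{j-l}(a_{j-l}) ψ_l(a_l))_j`. -/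
def quadratic (h : IsSymbol ψ ψ' g L) (k : Lattice → Lattice → ℂ) (hk : ∀ j l, ‖k j l‖ ≤ 1)
    (a : Seq) : Seq :=
  convOp k hk (h.superpos a) (h.superpos a)

/-- The Gateaux derivative of `quadratic`. -/
def quadraticDeriv (h : IsSymbol ψ ψ' g L) (k : Lattice → Lattice → ℂ) (hk : ∀ j l, ‖k j l‖ ≤ 1)
    (a : Seq) : Seq →L[ℝ] Seq :=
  ((convOp (fun j l => k j (j - l)) (fun j l => hk j (j - l)) (h.superpos a) +
    convOp k hk (h.superpos a)).restrictScalars ℝ) ∘L h.superposDeriv a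

lemma tendsto_coord_slope (h : IsSymbol ψ ψ' g L) (a v : Seq) (j : Lattice) :
    Tendsto (fun t : ℝ => t⁻¹ • (ψ j (a j + t • v j) - ψ j (a j))) (𝓝[≠] 0)
      (𝓝 (ψ' j (a j) (v j))) := by
  have h1 := (h.hasFDerivAt j (a j)).hasLineDerivAt (v j)
  have h2 := hasDerivAt_iff_tendsto_slope_zero.1 h1
  simpa using h2

/-- Dominated convergence: each coordinate converges, and the squared errors are at most
`(2L|v_j|)²`. This majorant is tied to the fixed direction `v`. -/
lemma tendsto_slope_superpos (h : IsSymbol ψ ψ' g L) (a v : Seq) :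
    Tendsto (fun t : ℝ => t⁻¹ • (h.superpos (a + t • v) - h.superpos a)) (𝓝[≠] 0)
      (𝓝 (h.superposDeriv a v)) := by
  rw [tendsto_iff_norm_sub_tendsto_zero]
  have hL := h.bound_nonneg
  have hsq : Tendsto (fun t : ℝ =>
      ‖t⁻¹ • (h.superpos (a + t • v) - h.superpos a) - h.superposDeriv a v‖ ^ 2) (𝓝[≠] 0)
      (𝓝 0) := by
    have hlim := tendsto_tsum_of_dominated_convergence (𝓕 := 𝓝[≠] (0 : ℝ))
      (f := fun (t : ℝ) (j : Lattice) =>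
        ‖t⁻¹ • (ψ j (a j + t • v j) - ψ j (a j)) - ψ' j (a j) (v j)‖ ^ 2)
      (g := fun _ => 0) (bound := fun j => (2 * L) ^ 2 * ‖v j‖ ^ 2)
      (v.summable.mul_left _) (fun j => ?_) ?_
    · rw [tsum_zero] at hlim
      refine hlim.congr fun t => ?_
      rw [Seq.norm_sq]
      rfl
    · have := ((h.tendsto_coord_slope a v j).sub_const (ψ' j (a j) (v j))).norm.pow 2
      simpa using this
    · filter_upwards [self_mem_nhdsWithin] with t ht j
      have ht' : t ≠ 0 := ht
      rw [norm_pow, norm_norm, ← mul_pow]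
      refine pow_le_pow_left₀ (norm_nonneg _) ?_ 2
      have e1 : ‖t⁻¹ • (ψ j (a j + t • v j) - ψ j (a j))‖ ≤ L * ‖v j‖ := by
        have := h.norm_sub_le j (a j + t • v j) (a j)
        rw [add_sub_cancel_left, norm_smul] at this
        rw [norm_smul, norm_inv]
        have htn : 0 < ‖t‖ := norm_pos_iff.2 ht'
        rw [inv_mul_le_iff₀ htn]
        linarith
      have e2 : ‖ψ' j (a j) (v j)‖ ≤ L * ‖v j‖ := (ψ' j (a j)).le_of_opNorm_le
        (h.norm_deriv_le j _) _
      linarith [_root_.norm_sub_le (t⁻¹ • (ψ j (a j + t • v j) - ψ j (a j))) (ψ' j (a j) (v j))]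
  have := hsq.sqrt
  simpa only [Real.sqrt_zero, Real.sqrt_sq (norm_nonneg _)] using this

/-- Convergence in operator norm: it is controlled by an `ℓ¹` norm, to which dominated convergence
applies with majorant `2 g`. -/
lemma tendsto_convOp_superpos (h : IsSymbol ψ ψ' g L) (k : Lattice → Lattice → ℂ)
    (hk : ∀ j l, ‖k j l‖ ≤ 1) (a v : Seq) :
    Tendsto (fun t : ℝ => convOp k hk (h.superpos (a + t • v))) (𝓝[≠] 0)
      (𝓝 (convOp k hk (h.superpos a))) := by
  rw [tendsto_iff_norm_sub_tendsto_zero]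
  have hlim := tendsto_tsum_of_dominated_convergence (𝓕 := 𝓝[≠] (0 : ℝ))
    (f := fun (t : ℝ) (j : Lattice) => ‖ψ j (a j + t • v j) - ψ j (a j)‖)
    (g := fun _ => 0) (bound := fun j => 2 * g j) (h.summable.mul_left _) (fun j => ?_) ?_
  · rw [tsum_zero] at hlim
    refine squeeze_zero (fun t => norm_nonneg _) (fun t => ?_) hlim
    rw [convOp_sub (h.summable_superpos _) (h.summable_superpos _)]
    refine norm_convOp_le ?_
    refine Summable.of_nonneg_of_le (fun _ => norm_nonneg _) (fun j => _root_.norm_sub_le _ _)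
      ((h.summable_norm (a + t • v : Seq)).add (h.summable_norm a))
  · have hc : Continuous fun t : ℝ => ‖ψ j (a j + t • v j) - ψ j (a j)‖ := by
      have : Continuous (ψ j) :=
        continuous_iff_continuousAt.2 fun z => (h.hasFDerivAt j z).continuousAt
      fun_prop
    have := (hc.tendsto 0).mono_left (nhdsWithin_le_nhds (s := {0}ᶜ))
    simpa using this
  · refine Eventually.of_forall fun t j => ?_
    rw [norm_norm]
    linarith [_root_.norm_sub_le (ψ j (a j + t • v j)) (ψ j (a j)), h.norm_le j (a j),
      h.norm_le j (a j + t • v j)]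

lemma hasLineDerivAt_quadratic (h : IsSymbol ψ ψ' g L) (k : Lattice → Lattice → ℂ)
    (hk : ∀ j l, ‖k j l‖ ≤ 1) (a v : Seq) :
    HasLineDerivAt ℝ (h.quadratic k hk) (h.quadraticDeriv k hk a v) a v := by
  refine hasDerivAt_iff_tendsto_slope_zero.2 ?_
  have hk' : ∀ j l, ‖k j (j - l)‖ ≤ 1 := fun j l => hk j (j - l)
  have hA := ((h.tendsto_convOp_superpos (fun j l => k j (j - l)) hk' a v).add_const
    (convOp k hk (h.superpos a)))
  have hlim := (isBoundedBilinearMap_apply (𝕜 := ℂ) (E := Seq) (F := Seq)).continuous.tendsto _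
    |>.comp (hA.prodMk_nhds (h.tendsto_slope_superpos a v))
  refine hlim.congr fun t => ?_
  -- An exact difference formula for the quadratic map, from bilinearity and `convOp_swap`; one
  -- operator is evaluated at `b`, the other at `a`, so no second-order remainder appears.
  have key : ∀ b : Seq, (convOp (fun j l => k j (j - l)) hk' (h.superpos b) +
      convOp k hk (h.superpos a)) (h.superpos b - h.superpos a) =
      h.quadratic k hk b - h.quadratic k hk a := by
    intro b
    have e1 := convOp_swap (hk := hk) (h.superpos a) (h.superpos b) (h.summable_norm a)
      (h.summable_norm b)
    have e2 := convOp_swap (hk := hk) (h.superpos b) (h.superpos b) (h.summable_norm b)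
      (h.summable_norm b)
    simp only [quadratic, _root_.add_apply, map_sub]
    rw [← e1, ← e2]
    abel
  rw [zero_add, zero_smul, add_zero, ← key]
  exact ContinuousLinearMap.map_smul_of_tower _ _ _

/-- The diagonal factor commutes with the restriction to `s`, so the compression falls directly on
the two convolution-type operators; they account for the factor `2`. -/
lemma norm_restrictOp_quadraticDeriv_le (h : IsSymbol ψ ψ' g L) (k : Lattice → Lattice → ℂ)
    (hk : ∀ j l, ‖k j l‖ ≤ 1) {s : Set Lattice} {t : Lattice → ℝ} (ht : Summable t)
    (ht0 : ∀ m, 0 ≤ t m) (hs : ∀ m, ∀ j ∈ s, j - m ∈ s → g m ≤ t m) (a b : Seq) :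
    ‖restrictOp s (h.quadraticDeriv k hk a (restrictOp s b))‖ ≤ 2 * L * (∑' m, t m) * ‖b‖ := by
  have hcomm : h.superposDeriv a (restrictOp s b) = restrictOp s (h.superposDeriv a b) := by
    classical
    ext j
    rw [restrictOp_apply, superposDeriv, diagOp_apply, diagOp_apply, restrictOp_apply]
    split_ifs <;> simp
  have hb := (h.superposDeriv a).le_of_opNorm_le (norm_diagOp_le _ _ _ _) b
  have hs' : ∀ m, ∀ j ∈ s, j - m ∈ s → ‖h.superpos a m‖ ≤ t m := fun m j hj hjm =>
    (h.norm_le m _).trans (hs m j hj hjm)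
  have h1 := norm_restrictOp_convOp_le (hk := hk) (h.summable_norm a) ht ht0 hs'
    (h.superposDeriv a b)
  have h2 := norm_restrictOp_convOp_le (hk := fun j l => hk j (j - l)) (h.summable_norm a) ht ht0
    hs' (h.superposDeriv a b)
  have e : h.quadraticDeriv k hk a (restrictOp s b) =
      convOp (fun j l => k j (j - l)) (fun j l => hk j (j - l)) (h.superpos a)
        (restrictOp s (h.superposDeriv a b)) +
      convOp k hk (h.superpos a) (restrictOp s (h.superposDeriv a b)) := by
    rw [← hcomm]; rfl
  rw [e, map_add]
  have hT : 0 ≤ ∑' m, t m := tsum_nonneg ht0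
  calc _ ≤ (∑' m, t m) * ‖h.superposDeriv a b‖ + (∑' m, t m) * ‖h.superposDeriv a b‖ :=
        (norm_add_le _ _).trans (add_le_add h2 h1)
    _ ≤ (∑' m, t m) * (L * ‖b‖) + (∑' m, t m) * (L * ‖b‖) := by gcongr
    _ = _ := by ring

end IsSymbol

/-! ### The symbol of the truncation -/

lemma norm_freq_le_len (j : Lattice) : ‖j‖ ≤ len j := by
  rw [pi_norm_le_iff_of_nonneg (len_nonneg j)]
  intro i
  rw [Int.norm_eq_abs]
  refine Real.abs_le_sqrt ?_
  fin_cases i <;> simp <;> positivity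

lemma len_rpow_neg_le {r : ℝ} (hr : 0 < r) (j : Lattice) : len j ^ (-r) ≤ ‖j‖ ^ (-r) := by
  rcases eq_or_ne j 0 with rfl | hj
  · simp [len_zero]
  · exact Real.rpow_le_rpow_of_nonpos (norm_pos_iff.2 hj) (norm_freq_le_len j) (by linarith)

lemma summable_norm_freq {r : ℝ} (hr : 2 < r) : Summable fun j : Lattice => ‖j‖ ^ (-r) :=
  EisensteinSeries.summable_one_div_norm_rpow hr

lemma summable_len {r : ℝ} (hr : 2 < r) : Summable fun j : Lattice => len j ^ (-r) :=
  Summable.of_nonneg_of_le (fun j => Real.rpow_nonneg (len_nonneg j) _)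
    (len_rpow_neg_le (by linarith)) (summable_norm_freq hr)

/-- The action of the truncation `W` on the coordinate in the `j`-th eigenvector. -/
def truncSymbol (ε ρ : ℝ) (θ : ℂ → ℂ) (j : Lattice) (z : ℂ) : ℂ :=
  ∑ n, ehat j n * (((ρ / len j ^ (3 + ε) : ℝ) : ℂ) *
    θ (((len j ^ (3 + ε) : ℝ) : ℂ) * (z * ehat j n) / (ρ : ℂ)))

lemma norm_truncSymbol_le {ε ρ : ℝ} (hρ : 0 < ρ) {θ : ℂ → ℂ} (hθ : IsCutoff θ)
    (j : Lattice) (z : ℂ) : ‖truncSymbol ε ρ θ j z‖ ≤ 4 * ρ * len j ^ (-(3 + ε)) := by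
  have hterm : ∀ n, ‖ehat j n * (((ρ / len j ^ (3 + ε) : ℝ) : ℂ) *
      θ (((len j ^ (3 + ε) : ℝ) : ℂ) * (z * ehat j n) / (ρ : ℂ)))‖ ≤
      2 * ρ * len j ^ (-(3 + ε)) := by
    intro n
    have hR := Real.rpow_nonneg (len_nonneg j) (3 + ε)
    rw [norm_mul, norm_mul, Complex.norm_real, Real.norm_eq_abs,
      abs_of_nonneg (div_nonneg hρ.le hR), Real.rpow_neg (len_nonneg j)]
    calc _ ≤ 1 * (ρ / len j ^ (3 + ε) * 2) := by
          gcongr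
          · exact norm_ehat_le_one j n
          · exact hθ.norm_le _
      _ = _ := by rw [div_eq_mul_inv]; ring
  refine (norm_sum_le _ _).trans ?_
  rw [Fin.sum_univ_two]
  linarith [hterm 0, hterm 1]

lemma truncSymbol_zero (ε ρ : ℝ) (θ : ℂ → ℂ) (z : ℂ) : truncSymbol ε ρ θ 0 z = 0 := by
  simp [truncSymbol, ehat_zero]

lemma differentiable_truncSymbol (ε ρ : ℝ) {θ : ℂ → ℂ} (hθ : IsCutoff θ) (j : Lattice) :
    Differentiable ℝ (truncSymbol ε ρ θ j) := by
  have h : Differentiable ℝ θ := hθ.smooth.differentiable (by norm_num)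
  unfold truncSymbol
  fun_prop

/-- The scalings by `|j|^{3+ε}/ρ` inside `θ` and by its inverse outside cancel, so the Lipschitz
constant does not depend on `j`; the two components give the factor `2`. -/
lemma norm_truncSymbol_sub_le {ε ρ : ℝ} (hρ : 0 < ρ) {θ : ℂ → ℂ} {K : NNReal}
    (hK : LipschitzWith K θ) (j : Lattice) (x y : ℂ) :
    ‖truncSymbol ε ρ θ j x - truncSymbol ε ρ θ j y‖ ≤ 2 * K * ‖x - y‖ := by
  rcases eq_or_ne j 0 with rfl | hj
  · simp only [truncSymbol_zero, sub_self, norm_zero]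
    positivity
  unfold truncSymbol
  rw [← Finset.sum_sub_distrib]
  refine (norm_sum_le _ _).trans ?_
  have hR : 0 < len j ^ (3 + ε) := Real.rpow_pos_of_pos (len_pos hj) _
  set R := len j ^ (3 + ε)
  have hterm : ∀ n, ‖ehat j n * (((ρ / R : ℝ) : ℂ) * θ ((R : ℂ) * (x * ehat j n) / (ρ : ℂ))) -
      ehat j n * (((ρ / R : ℝ) : ℂ) * θ ((R : ℂ) * (y * ehat j n) / (ρ : ℂ)))‖ ≤
      K * ‖x - y‖ := by
    intro n
    have h1 := hK.norm_sub_le ((R : ℂ) * (x * ehat j n) / (ρ : ℂ))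
      ((R : ℂ) * (y * ehat j n) / (ρ : ℂ))
    have h2 : (R : ℂ) * (x * ehat j n) / (ρ : ℂ) - (R : ℂ) * (y * ehat j n) / (ρ : ℂ) =
        ((R / ρ : ℝ) : ℂ) * ((x - y) * ehat j n) := by
      push_cast; ring
    rw [h2, norm_mul, norm_mul, Complex.norm_real, Real.norm_of_nonneg (by positivity)] at h1
    rw [← mul_sub, ← mul_sub, norm_mul, norm_mul, Complex.norm_real,
      Real.norm_of_nonneg (by positivity)]
    have he := norm_ehat_le_one j n
    calc _ ≤ 1 * (ρ / R * (K * (R / ρ * (‖x - y‖ * 1)))) := by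
          gcongr
          exact h1.trans (by gcongr)
      _ = K * ‖x - y‖ := by field_simp
  rw [Fin.sum_univ_two]
  linarith [hterm 0, hterm 1]

lemma exists_isSymbol_truncSymbol {ε ρ : ℝ} (hε : 0 < ε) (hρ : 0 < ρ) {θ : ℂ → ℂ}
    (hθ : IsCutoff θ) :
    ∃ L, IsSymbol (truncSymbol ε ρ θ) (fun j => fderiv ℝ (truncSymbol ε ρ θ j))
      (fun j => 4 * ρ * len j ^ (-(3 + ε))) L := by
  obtain ⟨K, hK⟩ := hθ.smooth.lipschitzWith_of_hasCompactSupport hθ.hasCompactSupport (by norm_num)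
  refine ⟨2 * K, fun j z => (differentiable_truncSymbol ε ρ hθ j z).hasFDerivAt, fun j z => ?_,
    norm_truncSymbol_le hρ hθ, (summable_len (by linarith)).mul_left _⟩
  have : LipschitzWith (2 * K) (truncSymbol ε ρ θ j) :=
    LipschitzWith.of_dist_le_mul fun x y => by
      rw [dist_eq_norm, dist_eq_norm]
      simpa using norm_truncSymbol_sub_le hρ hK j x y
  simpa using norm_fderiv_le_of_lipschitz ℝ this

/-! ### The nonlinearity, its derivative and its compression -/

lemma truncW_eq_synth (ε ρ : ℝ) (θ : ℂ → ℂ) (u : H) :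
    truncW ε ρ θ u = synth fun j => truncSymbol ε ρ θ j (coord u j) := by
  rw [← tsum_subtype_eq_synth]
  simp only [truncW, mode_eq, fieldCoeff_eq, truncSymbol, coord_apply, Pi.smul_apply, smul_eq_mul]

lemma coord_nonlinearity {β ρ : ℝ} (hβ : 17 / 12 < β) (hρ : 0 < ρ) {θ : ℂ → ℂ} (hθ : IsCutoff θ)
    {ψ' : Lattice → ℂ → ℂ →L[ℝ] ℂ} {g : Lattice → ℝ} {L : ℝ}
    (h : IsSymbol (truncSymbol (2 * β - 17 / 6) ρ θ) ψ' g L) (u : H) :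
    coord (nonlinearity β ρ θ u) = h.quadratic kernel norm_kernel_le (coord u) := by
  set ε := 2 * β - 17 / 6 with hε
  have hw : ∀ j, inner ℂ (eigenvector j) (truncW ε ρ θ u) = truncSymbol ε ρ θ j (coord u j) := by
    intro j
    rw [truncW_eq_synth, inner_synth (h.summable_norm _) (truncSymbol_zero _ _ _ _)]
  ext j
  -- One derivative of `W(u)` costs a factor `|j|`; the remaining decay `|j|^{-(2+ε)}` is still
  -- summable over the planar lattice.
  have hs' : Summable fun j => len j * ‖inner ℂ (eigenvector j) (truncW ε ρ θ u)‖ := by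
    refine Summable.of_nonneg_of_le (fun j => mul_nonneg (len_nonneg j) (norm_nonneg _))
      (fun j => ?_) ((summable_len (r := 2 + ε) (by linarith)).mul_left (4 * ρ))
    rw [hw]
    rcases eq_or_ne j 0 with rfl | hj
    · rw [len_zero, zero_mul]
      positivity
    · have h1 := norm_truncSymbol_le (ε := ε) hρ hθ j (coord u j)
      have h2 : len j ^ (-(2 + ε)) = len j * len j ^ (-(3 + ε)) := by
        rw [← Real.rpow_one_add' (len_nonneg j) (by linarith)]
        congr 1
        ring
      rw [h2]
      calc _ ≤ len j * (4 * ρ * len j ^ (-(3 + ε))) :=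
            mul_le_mul_of_nonneg_left h1 (len_nonneg j)
        _ = _ := by ring
  have hs : Summable fun j => ‖inner ℂ (eigenvector j) (truncW ε ρ θ u)‖ := by
    simp only [hw]
    exact h.summable_norm _
  have h1 := hasSum_inner_invSqrtA_bilinB hs hs' j
  refine h1.unique ((hasSum_convOp_coord' (h.summable_superpos _) _ j).congr_fun fun l => ?_)
  rw [hw, hw]
  rfl

/-- The Gateaux derivative of the nonlinearity. -/
def nonlinearityDeriv {ψ : Lattice → ℂ → ℂ} {ψ' : Lattice → ℂ → ℂ →L[ℝ] ℂ} {g : Lattice → ℝ}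
    {L : ℝ} (h : IsSymbol ψ ψ' g L) (u : H) : H →L[ℝ] H :=
  ofCoord.restrictScalars ℝ ∘L h.quadraticDeriv kernel norm_kernel_le (coord u) ∘L
    coord.toContinuousLinearMap.restrictScalars ℝ

lemma hasGateauxDerivAt_nonlinearity {β ρ : ℝ} (hβ : 17 / 12 < β) (hρ : 0 < ρ) {θ : ℂ → ℂ}
    (hθ : IsCutoff θ) {ψ' : Lattice → ℂ → ℂ →L[ℝ] ℂ} {g : Lattice → ℝ} {L : ℝ}
    (h : IsSymbol (truncSymbol (2 * β - 17 / 6) ρ θ) ψ' g L) (u : H) :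
    HasGateauxDerivAt (nonlinearity β ρ θ) (nonlinearityDeriv h u) u := by
  intro v
  have h1 : HasDerivAt _ _ _ := h.hasLineDerivAt_quadratic kernel norm_kernel_le (coord u) (coord v)
  have h2 := (ofCoord.restrictScalars ℝ).hasFDerivAt.comp_hasDerivAt (0 : ℝ) h1
  change HasDerivAt _ _ _
  convert h2 using 1
  · funext t
    have h3 : coord (u + t • v) = coord u + t • coord v := by
      rw [map_add]
      congr 1
      exact coord.toContinuousLinearMap.map_smul_of_tower t v
    change _ = ofCoord (h.quadratic kernel norm_kernel_le (coord u + t • coord v))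
    rw [← h3, ← coord_nonlinearity hβ hρ hθ h, ofCoord_coord]
  · rfl

lemma coord_spectralProj (a b : ℝ) (u : H) :
    coord (spectralProj a b u) =
      restrictOp {j | j ≠ 0 ∧ a ≤ len j ^ 2 ∧ len j ^ 2 ≤ b} (coord u) := by
  classical
  ext j
  rw [restrictOp_apply, coord_apply, spectralProj, sum_apply, inner_sum]
  have : ∀ l, inner ℂ (eigenvector j)
      ((innerSL ℂ (eigenvector l)).smulRight (eigenvector l) u) =
      if j = l then (if j ≠ 0 then coord u j else 0) else 0 := by
    intro l
    refine (inner_smul_right (𝕜 := ℂ) (eigenvector j) (eigenvector l) _).trans ?_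
    rw [inner_eigenvector_eigenvector]
    by_cases hl : j = l
    · subst hl
      by_cases h : j = 0 <;> simp [h, coord_apply]
    · simp [hl]
  simp only [this, Finset.sum_ite_eq, Set.Finite.mem_toFinset]
  by_cases hj : j ∈ {j : Lattice | j ≠ 0 ∧ a ≤ len j ^ 2 ∧ len j ^ 2 ≤ b}
  · rw [if_pos hj, if_pos hj, if_pos hj.1]
  · rw [if_neg hj, if_neg hj]

lemma norm_midProj_comp_le {ψ : Lattice → ℂ → ℂ} {ψ' : Lattice → ℂ → ℂ →L[ℝ] ℂ} {g : Lattice → ℝ}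
    {L : ℝ} (h : IsSymbol ψ ψ' g L) (k : ℝ) (N : ℕ) {t : Lattice → ℝ} (ht : Summable t)
    (ht0 : ∀ m, 0 ≤ t m)
    (hs : ∀ m, ∀ j ∈ {j : Lattice | j ≠ 0 ∧ eigenvalue N - k ≤ len j ^ 2 ∧
        len j ^ 2 ≤ eigenvalue N + k},
      j - m ∈ {j : Lattice | j ≠ 0 ∧ eigenvalue N - k ≤ len j ^ 2 ∧
        len j ^ 2 ≤ eigenvalue N + k} → g m ≤ t m) (u : H) :
    ‖midProj k N ∘L nonlinearityDeriv h u ∘L midProj k N‖ ≤ 2 * L * ∑' m, t m := by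
  classical
  refine ContinuousLinearMap.opNorm_le_bound _
    (mul_nonneg (mul_nonneg zero_le_two h.bound_nonneg) (tsum_nonneg ht0)) fun v => ?_
  have h1 := h.norm_restrictOp_quadraticDeriv_le kernel norm_kernel_le ht ht0 hs (coord u) (coord v)
  rw [coord.norm_map] at h1
  refine le_trans (le_of_eq ?_) h1
  rw [← coord.norm_map]
  congr 1
  change coord (spectralProj _ _ (ofCoord (h.quadraticDeriv kernel norm_kernel_le (coord u)
    (coord (spectralProj _ _ v))))) = _
  rw [coord_spectralProj, coord_spectralProj]
  ext j
  rw [restrictOp_apply, restrictOp_apply]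
  split_ifs with hj
  -- The window excludes `j = 0`, the only frequency at which `ofCoord` does not recover the
  -- sequence.
  · exact coord_ofCoord _ hj.1
  · rfl

/-! ### Counting resonant pairs and finding a sparse annulus -/

lemma card_le_of_spread {T : Finset ℤ} {d K : ℤ} (hd : 0 < d) (hK : 0 ≤ K)
    (h : ∀ a ∈ T, ∀ b ∈ T, d * (a - b) ≤ K) : (T.card : ℤ) ≤ K / d + 1 := by
  have hq : 0 ≤ K / d := Int.ediv_nonneg hK hd.le
  rcases T.eq_empty_or_nonempty with rfl | hT
  · simp; omega
  have hsub : T ⊆ Finset.Icc (T.min' hT) (T.min' hT + K / d) := by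
    intro a ha
    rw [Finset.mem_Icc]
    refine ⟨T.min'_le a ha, ?_⟩
    have h1 := h a ha _ (T.min'_mem hT)
    have : a - T.min' hT ≤ K / d := (Int.le_ediv_iff_mul_le hd).2 (by linarith)
    linarith
  have := Finset.card_le_card hsub
  rw [Int.card_Icc] at this
  omega

/-- Quadruples `(m₁, m₀, j₀, j₁)` with `0 < |m₁| ≤ M`, `|m₀| ≤ |m₁|`, `|j_i| ≤ X` such that `|j|²` and
`|j - m|²` differ by at most `2K`. -/
def resonances (M X K : ℤ) : Finset (ℤ × ℤ × ℤ × ℤ) :=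
  (Finset.Icc (-M) M ×ˢ Finset.Icc (-M) M ×ˢ Finset.Icc (-X) X ×ˢ Finset.Icc (-X) X).filter
    fun q => q.1 ≠ 0 ∧ |q.2.1| ≤ |q.1| ∧
      |2 * (q.2.2.1 * q.2.1 + q.2.2.2 * q.1) - (q.2.1 ^ 2 + q.1 ^ 2)| ≤ 2 * K

/-- For fixed `m₁`, `m₀`, `j₀` the last condition confines `j₁` to an interval of length `2K/|m₁|`.
As `|m₀| ≤ |m₁|`, there are at most `3|m₁|` choices of `m₀`, which cancels the denominator:
`(2K/|m₁| + 1) · 3|m₁| ≤ 3(2K + M)`. -/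
lemma card_resonances_le {M X K : ℤ} (hM : 0 ≤ M) (hX : 0 ≤ X) (hK : 0 ≤ K) :
    ((resonances M X K).card : ℤ) ≤ 3 * (2 * X + 1) * (2 * K + M) * (2 * M + 1) := by
  classical
  have hfib : ∀ m₁ ∈ Finset.Icc (-M) M,
      ((resonances M X K).filter fun q => q.1 = m₁).card ≤
        (3 * (2 * X + 1) * (2 * K + M)).toNat := by
    intro m₁ hm₁
    rw [Finset.mem_Icc, ← abs_le] at hm₁
    have hB : 0 ≤ 3 * (2 * X + 1) * (2 * K + M) := by positivity
    rcases eq_or_ne m₁ 0 with rfl | hne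
    · rw [Finset.card_eq_zero.2]
      · exact Nat.zero_le _
      · refine Finset.filter_eq_empty_iff.2 fun q hq h0 => ?_
        exact (Finset.mem_filter.1 hq).2.1 h0
    have hpos : 0 < |m₁| := abs_pos.2 hne
    have hinner : ∀ p ∈ Finset.Icc (-|m₁|) |m₁| ×ˢ Finset.Icc (-X) X,
        (((resonances M X K).filter fun q => q.1 = m₁).filter
          fun q => (q.2.1, q.2.2.1) = p).card ≤ (2 * K / |m₁| + 1).toNat := by
      rintro ⟨m₀, j₀⟩ -
      set S := ((resonances M X K).filter fun q => q.1 = m₁).filter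
          fun q => (q.2.1, q.2.2.1) = (m₀, j₀) with hS
      have hmem : ∀ q ∈ S, q.1 = m₁ ∧ q.2.1 = m₀ ∧ q.2.2.1 = j₀ ∧
          |2 * (j₀ * m₀ + q.2.2.2 * m₁) - (m₀ ^ 2 + m₁ ^ 2)| ≤ 2 * K := by
        intro q hq
        rw [hS, Finset.mem_filter, Finset.mem_filter, resonances, Finset.mem_filter] at hq
        obtain ⟨⟨⟨-, -, -, h3⟩, h1⟩, h2⟩ := hq
        rw [Prod.mk.injEq] at h2
        rw [h1, h2.1, h2.2] at h3
        exact ⟨h1, h2.1, h2.2, h3⟩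
      have hinj : Set.InjOn (fun q : ℤ × ℤ × ℤ × ℤ => q.2.2.2) S := by
        rintro ⟨a, b, c, d⟩ hq ⟨a', b', c', d'⟩ hq' h
        obtain ⟨h1, h2, h3, -⟩ := hmem _ hq
        obtain ⟨h1', h2', h3', -⟩ := hmem _ hq'
        simp only at h h1 h2 h3 h1' h2' h3'
        subst h1 h2 h3 h1' h2' h3' h
        rfl
      rw [← Finset.card_image_of_injOn hinj, Int.le_toNat (by positivity)]
      refine card_le_of_spread hpos (by positivity) ?_
      intro a ha b hb
      rw [Finset.mem_image] at ha hb
      obtain ⟨q, hq, rfl⟩ := ha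
      obtain ⟨q', hq', rfl⟩ := hb
      have h1 := abs_le.1 (hmem q hq).2.2.2
      have h2 := abs_le.1 (hmem q' hq').2.2.2
      rcases abs_cases m₁ with ⟨e, -⟩ | ⟨e, -⟩ <;> rw [e] <;> nlinarith
    have hmaps : ∀ q ∈ (resonances M X K).filter fun q => q.1 = m₁,
        (q.2.1, q.2.2.1) ∈ Finset.Icc (-|m₁|) |m₁| ×ˢ Finset.Icc (-X) X := by
      intro q hq
      simp only [resonances, Finset.mem_filter, Finset.mem_product] at hq ⊢
      obtain ⟨⟨⟨-, -, h3, -⟩, -, h5, -⟩, h1⟩ := hq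
      rw [h1] at h5
      exact ⟨Finset.mem_Icc.2 (abs_le.1 h5), h3⟩
    have hcard := Finset.card_le_mul_card_image_of_maps_to hmaps _ hinner
    rw [Finset.card_product, Int.card_Icc, Int.card_Icc] at hcard
    rw [Int.le_toNat hB]
    have hq : 0 ≤ 2 * K / |m₁| := by positivity
    have h1 : ((((2 * K / |m₁| + 1).toNat * ((|m₁| + 1 - -|m₁|).toNat *
        (X + 1 - -X).toNat) : ℕ)) : ℤ) = (2 * K / |m₁| + 1) * ((2 * |m₁| + 1) * (2 * X + 1)) := by
      push_cast
      rw [Int.toNat_of_nonneg (by positivity), Int.toNat_of_nonneg (by linarith),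
        Int.toNat_of_nonneg (by linarith)]
      ring
    have h2 : ((((resonances M X K).filter fun q => q.1 = m₁).card : ℕ) : ℤ) ≤ _ :=
      (Int.ofNat_le.2 hcard).trans_eq h1
    refine h2.trans ?_
    have h3 : 2 * K / |m₁| * |m₁| ≤ 2 * K := Int.ediv_mul_le _ hpos.ne'
    have h4 : (2 * K / |m₁| + 1) * (2 * |m₁| + 1) ≤ 3 * (2 * K + M) := by nlinarith
    calc _ = (2 * K / |m₁| + 1) * (2 * |m₁| + 1) * (2 * X + 1) := by ring
      _ ≤ 3 * (2 * K + M) * (2 * X + 1) := by gcongr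
      _ = _ := by ring
  have hmaps : ∀ q ∈ resonances M X K, q.1 ∈ Finset.Icc (-M) M := by
    intro q hq
    simp only [resonances, Finset.mem_filter, Finset.mem_product] at hq
    exact hq.1.1
  have hcard := Finset.card_le_mul_card_image_of_maps_to hmaps _ hfib
  rw [Int.card_Icc] at hcard
  refine (Int.ofNat_le.2 hcard).trans_eq ?_
  push_cast
  rw [Int.toNat_of_nonneg (by positivity), Int.toNat_of_nonneg (by linarith)]
  ring

/-- Sums `x² + y²` in the range considered are separated. -/
lemma eq_of_sq_add_sq_close {Y x y x' y' : ℤ} (hY : 0 < Y) (hx : 4 * Y ^ 2 ≤ x)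
    (hx' : 4 * Y ^ 2 ≤ x') (hy : Y ≤ y) (hy2 : y < 2 * Y) (hy' : Y ≤ y') (hy2' : y' < 2 * Y)
    (h : |x ^ 2 + y ^ 2 - (x' ^ 2 + y' ^ 2)| ≤ 2 * Y) : x = x' ∧ y = y' := by
  rw [abs_le] at h
  have hxx : x = x' := by
    -- Squares of distinct `x` differ by more than `8Y²`, whereas those of `y` vary by less than
    -- `3Y²`.
    rcases lt_trichotomy x x' with hlt | heq | hlt
    · have : x ^ 2 + 2 * x + 1 ≤ x' ^ 2 := by nlinarith
      nlinarith
    · exact heq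
    · have : x' ^ 2 + 2 * x' + 1 ≤ x ^ 2 := by nlinarith
      nlinarith
  subst hxx
  refine ⟨rfl, ?_⟩
  -- With equal `x`, distinct `y ≥ Y` have squares differing by at least `2Y + 1`.
  rcases lt_trichotomy y y' with hlt | heq | hlt
  · nlinarith
  · exact heq
  · nlinarith

/-- There are sums of two squares such that distinct lattice points close to the circle are far
apart. -/
theorem exists_sparse_annulus {M K : ℤ} (hM : 1 ≤ M) (hK : 0 ≤ K)
    (hMK : 95 * (2 * K + M) < M ^ 2) :
    ∃ x y : ℤ, 4 * M ^ 6 ≤ x ∧ x < 8 * M ^ 6 ∧ M ^ 3 ≤ y ∧ y < 2 * M ^ 3 ∧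
      ∀ j₀ j₁ m₀ m₁ : ℤ, |m₀| ≤ M → |m₁| ≤ M →
        |j₀ ^ 2 + j₁ ^ 2 - (x ^ 2 + y ^ 2)| ≤ K →
        |(j₀ - m₀) ^ 2 + (j₁ - m₁) ^ 2 - (x ^ 2 + y ^ 2)| ≤ K → m₀ = 0 ∧ m₁ = 0 := by
  classical
  by_contra hcon
  push Not at hcon
  set Y := M ^ 3 with hYdef
  have hY6 : M ^ 6 = Y ^ 2 := by rw [hYdef]; ring
  rw [hY6] at hcon
  have hY1 : 1 ≤ Y := one_le_pow₀ hM
  have hKY : 2 * K ≤ Y := by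
    have : M ^ 2 ≤ M ^ 3 := pow_le_pow_right₀ hM (by norm_num)
    linarith
  -- Large enough to contain every relevant `j`: `|j|² ≤ 64Y⁴ + 4Y² + K ≤ 100Y⁴`.
  set X := 10 * Y ^ 2 with hX
  set box := Finset.Ico (4 * Y ^ 2) (8 * Y ^ 2) ×ˢ Finset.Ico Y (2 * Y) with hbox
  -- Each failing centre yields a resonance, after exchanging the coordinates if `|m₁| < |m₀|`; the
  -- Boolean records the choice.
  have hex : ∀ p ∈ box, ∃ r : Bool × ℤ × ℤ × ℤ × ℤ, r.2 ∈ resonances M X K ∧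
      |r.2.2.2.1 ^ 2 + r.2.2.2.2 ^ 2 - (p.1 ^ 2 + p.2 ^ 2)| ≤ K := by
    rintro ⟨x, y⟩ hp
    rw [hbox, Finset.mem_product, Finset.mem_Ico, Finset.mem_Ico] at hp
    simp only at hp
    obtain ⟨⟨hx1, hx2⟩, hy1, hy2⟩ := hp
    obtain ⟨j₀, j₁, m₀, m₁, hm₀, hm₁, h1, h2, hne⟩ := hcon x y hx1 hx2 hy1 hy2
    have hres : |2 * (j₀ * m₀ + j₁ * m₁) - (m₀ ^ 2 + m₁ ^ 2)| ≤ 2 * K := by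
      rw [abs_le] at h1 h2 ⊢
      constructor <;> nlinarith
    have hsq : j₀ ^ 2 + j₁ ^ 2 ≤ X ^ 2 := by
      have e1 := (abs_le.1 h1).2
      have e2 : x ^ 2 ≤ (8 * Y ^ 2) ^ 2 := pow_le_pow_left₀ (by nlinarith) hx2.le 2
      have e3 : y ^ 2 ≤ (2 * Y) ^ 2 := pow_le_pow_left₀ (by linarith) hy2.le 2
      have e4 : Y ≤ Y ^ 4 := le_self_pow₀ hY1 (by norm_num)
      have e5 : Y ^ 2 ≤ Y ^ 4 := pow_le_pow_right₀ hY1 (by norm_num)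
      rw [hX]
      nlinarith
    have hX0 : 0 ≤ X := by positivity
    have hj₀ : |j₀| ≤ X := abs_le_of_sq_le_sq (by nlinarith [sq_nonneg j₁]) hX0
    have hj₁ : |j₁| ≤ X := abs_le_of_sq_le_sq (by nlinarith [sq_nonneg j₀]) hX0
    rw [abs_le] at hm₀ hm₁ hj₀ hj₁
    rcases le_total |m₀| |m₁| with hle | hle
    · refine ⟨(true, m₁, m₀, j₀, j₁), ?_, h1⟩
      simp only [resonances, Finset.mem_filter, Finset.mem_product, Finset.mem_Icc]
      refine ⟨⟨hm₁, hm₀, hj₀, hj₁⟩, fun h0 => ?_, hle, hres⟩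
      rw [h0, abs_zero] at hle
      exact hne (abs_nonpos_iff.1 hle) h0
    · refine ⟨(false, m₀, m₁, j₁, j₀), ?_, by rwa [add_comm (j₁ ^ 2)]⟩
      simp only [resonances, Finset.mem_filter, Finset.mem_product, Finset.mem_Icc]
      refine ⟨⟨hm₀, hm₁, hj₁, hj₀⟩, fun h0 => ?_, hle, ?_⟩
      · rw [h0, abs_zero] at hle
        exact hne h0 (abs_nonpos_iff.1 hle)
      · rwa [add_comm (j₁ * m₁), add_comm (m₁ ^ 2)]
  choose! f hf1 hf2 using hex
  -- Two centres sharing a resonance lie within `K` of the same `|j|²`, hence within `2K ≤ Y` of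
  -- each other, and coincide by separation.
  have hinj : Set.InjOn f box := by
    rintro ⟨x, y⟩ hp ⟨x', y'⟩ hp' heq
    have h1 := hf2 _ hp
    have h2 := hf2 _ hp'
    rw [heq] at h1
    rw [hbox, Finset.mem_coe, Finset.mem_product, Finset.mem_Ico, Finset.mem_Ico] at hp hp'
    simp only at hp hp' h1 h2
    obtain ⟨e1, e2⟩ := eq_of_sq_add_sq_close (x := x) (y := y) (x' := x') (y' := y')
      (by linarith) hp.1.1 hp'.1.1 hp.2.1 hp.2.2 hp'.2.1 hp'.2.2 (by
        rw [abs_le] at h1 h2 ⊢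
        constructor <;> linarith)
    rw [e1, e2]
  have hmaps : Set.MapsTo f box ((Finset.univ : Finset Bool) ×ˢ resonances M X K :) := by
    intro p hp
    exact Finset.mem_coe.2 (Finset.mem_product.2 ⟨Finset.mem_univ _, hf1 p hp⟩)
  have hcard := Finset.card_le_card_of_injOn f hmaps hinj
  rw [Finset.card_product, Finset.card_product, Int.card_Ico, Int.card_Ico, Finset.card_univ,
    Fintype.card_bool] at hcard
  have hcard' := Int.ofNat_le.2 hcard
  push_cast at hcard'
  rw [Int.toNat_of_nonneg (by nlinarith), Int.toNat_of_nonneg (by linarith)] at hcard'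
  have hQ := card_resonances_le (M := M) (X := X) (K := K) (by linarith) (by positivity) hK
  -- The box has `4Y³` points, the resonances with their flag number at most `2 · 189 · Y² (2K + M)
  -- M`, and `378 < 4 · 95`; this is the origin of the constant `95`.
  have h1 : 2 * X + 1 ≤ 21 * Y ^ 2 := by nlinarith
  have h2 : 3 * (2 * X + 1) * (2 * K + M) * (2 * M + 1) ≤
      3 * (21 * Y ^ 2) * (2 * K + M) * (3 * M) := by
    gcongr; linarith
  have h3 : 95 * (2 * K + M) * M < Y := by
    rw [hYdef]
    calc _ < M ^ 2 * M := by gcongr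
      _ = M ^ 3 := by ring
  have h4 : Y ^ 2 * (95 * (2 * K + M) * M) < Y ^ 2 * Y := by gcongr
  nlinarith

/-! ### Sparse windows in the spectrum -/

/-- The index is the number of nonzero lattice points with `|j|² ≤ n`, the last one carrying the
eigenvalue `n`; a smaller bound would lose the point `j` itself. -/
lemma exists_eigenvalue_eq {j : Lattice} (hj : j ≠ 0) {n : ℕ} (hn : (n : ℤ) = j 0 ^ 2 + j 1 ^ 2) :
    ∃ N : ℕ, 1 ≤ N ∧ eigenvalue N = n := by
  have hfin : ∀ m : ℕ, {j : Lattice | j ≠ 0 ∧ j 0 ^ 2 + j 1 ^ 2 ≤ (m : ℤ)}.Finite := by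
    intro m
    refine (finite_window 0 m).subset fun l hl => ⟨hl.1, by positivity, ?_⟩
    rw [len_sq]
    exact_mod_cast hl.2
  refine ⟨{j : Lattice | j ≠ 0 ∧ j 0 ^ 2 + j 1 ^ 2 ≤ (n : ℤ)}.ncard, ?_, ?_⟩
  · exact (Set.ncard_pos (hfin n)).2 ⟨j, hj, hn.ge⟩
  · refine le_antisymm (Nat.sInf_le (le_refl (Set.ncard _)))
      (le_csInf ⟨n, le_refl (Set.ncard _)⟩ fun m hm => ?_)
    by_contra! hlt
    have hss : {j : Lattice | j ≠ 0 ∧ j 0 ^ 2 + j 1 ^ 2 ≤ (m : ℤ)} ⊂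
        {j : Lattice | j ≠ 0 ∧ j 0 ^ 2 + j 1 ^ 2 ≤ (n : ℤ)} := by
      refine ⟨fun l hl => ⟨hl.1, hl.2.trans (by exact_mod_cast hlt.le)⟩, fun hsub => ?_⟩
      have : j 0 ^ 2 + j 1 ^ 2 ≤ (m : ℤ) := (hsub ⟨hj, hn.ge⟩).2
      omega
    exact absurd (Set.ncard_lt_ncard hss (hfin n)) (not_lt.2 hm)

lemma eventually_const_mul_rpow_lt {C δ : ℝ} (hδ : 0 < δ) {η : ℝ} (hη : 0 < η) :
    ∀ᶠ M : ℕ in atTop, C * (M : ℝ) ^ (-δ) < η := by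
  have h : Tendsto (fun M : ℕ => C * (M : ℝ) ^ (-δ)) atTop (𝓝 (C * 0)) :=
    ((tendsto_rpow_neg_atTop hδ).comp tendsto_natCast_atTop_atTop).const_mul C
  rw [mul_zero] at h
  exact h.eventually_lt_const hη

/-- The half-width is of order `M^{12s}`, which is `o(M²)` precisely because `s < 1/6`. -/
lemma eventually_window_width {s : ℝ} (hs0 : 0 < s) (hs : s < 1 / 6) :
    ∀ᶠ M : ℕ in atTop, 95 * (2 * ⌈(68 * (M : ℝ) ^ 12) ^ s⌉ + (M : ℤ)) < (M : ℤ) ^ 2 := by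
  filter_upwards [eventually_const_mul_rpow_lt (C := 1) (δ := 2 - 12 * s) (by linarith)
    (η := 1 / 40000) (by norm_num), eventually_ge_atTop 1000] with M h1 hM
  have hM' : (1000 : ℝ) ≤ M := by exact_mod_cast hM
  have hMpos : (0 : ℝ) < M := by linarith
  have e1 : (68 * (M : ℝ) ^ 12) ^ s ≤ 68 * (M : ℝ) ^ (12 * s) := by
    rw [Real.mul_rpow (by norm_num) (by positivity), ← Real.rpow_natCast, ← Real.rpow_mul hMpos.le]
    push_cast
    refine mul_le_mul_of_nonneg_right ?_ (by positivity)
    calc (68 : ℝ) ^ s ≤ 68 ^ (1 : ℝ) :=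
          Real.rpow_le_rpow_of_exponent_le (by norm_num) (by linarith)
      _ = 68 := Real.rpow_one _
  have e2 : (M : ℝ) ^ (12 * s) ≤ (M : ℝ) ^ 2 / 40000 := by
    have : (M : ℝ) ^ (12 * s) = (M : ℝ) ^ 2 * (M : ℝ) ^ (-(2 - 12 * s)) := by
      rw [← Real.rpow_natCast, ← Real.rpow_add hMpos]
      congr 1
      push_cast
      ring
    rw [this]
    nlinarith [sq_nonneg (M : ℝ)]
  have e3 := Int.ceil_lt_add_one ((68 * (M : ℝ) ^ 12) ^ s)
  have : (95 * (2 * (⌈(68 * (M : ℝ) ^ 12) ^ s⌉ : ℝ) + (M : ℝ))) < (M : ℝ) ^ 2 := by nlinarith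
  exact_mod_cast this

/-- Since `lam ^ (-a)` is at least a constant times `M^{-12a}` and `12a < 1`, the tail `C/M` is
eventually smaller. -/
lemma eventually_tail_le {a C : ℝ} (ha0 : 0 ≤ a) (ha : a < 1 / 12) :
    ∀ᶠ M : ℕ in atTop, ∀ lam : ℝ, 0 < lam → lam ≤ 68 * (M : ℝ) ^ 12 →
      C * (M : ℝ)⁻¹ ≤ 1 / 16 * lam ^ (-a) := by
  filter_upwards [eventually_const_mul_rpow_lt (C := C) (δ := 1 - 12 * a) (by linarith)
    (η := 1 / (16 * 68)) (by norm_num), eventually_ge_atTop 1] with M h1 hM lam hlam0 hlam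
  have hMpos : (0 : ℝ) < M := by exact_mod_cast hM
  have e1 : (68 * (M : ℝ) ^ 12) ^ (-a) ≤ lam ^ (-a) :=
    Real.rpow_le_rpow_of_nonpos hlam0 hlam (by linarith)
  have e2 : (68 : ℝ)⁻¹ * (M : ℝ) ^ (-(12 * a)) ≤ (68 * (M : ℝ) ^ 12) ^ (-a) := by
    rw [Real.mul_rpow (by norm_num) (by positivity), ← Real.rpow_natCast, ← Real.rpow_mul hMpos.le]
    push_cast
    rw [show (12 : ℝ) * -a = -(12 * a) by ring]
    refine mul_le_mul_of_nonneg_right ?_ (by positivity)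
    calc (68 : ℝ)⁻¹ = 68 ^ (-1 : ℝ) := (Real.rpow_neg_one _).symm
      _ ≤ 68 ^ (-a) := Real.rpow_le_rpow_of_exponent_le (by norm_num) (by linarith)
  have e3 : (M : ℝ)⁻¹ = (M : ℝ) ^ (-(1 - 12 * a)) * (M : ℝ) ^ (-(12 * a)) := by
    rw [← Real.rpow_add hMpos, ← Real.rpow_neg_one]
    congr 1
    ring
  have hp : 0 < (M : ℝ) ^ (-(12 * a)) := Real.rpow_pos_of_pos hMpos _
  rw [e3, ← mul_assoc]
  calc _ ≤ 1 / (16 * 68) * (M : ℝ) ^ (-(12 * a)) := by gcongr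
    _ = 1 / 16 * ((68 : ℝ)⁻¹ * (M : ℝ) ^ (-(12 * a))) := by ring
    _ ≤ _ := by gcongr; exact e2.trans e1

/-- Arbitrarily high in the spectrum there is an eigenvalue such that distinct frequencies of a
surrounding window are at distance more than `M`. -/
lemma exists_sparse_window {s : ℝ} (hs0 : 0 < s) {M : ℕ} (hM : 2 ≤ M)
    (hw : 95 * (2 * ⌈(68 * (M : ℝ) ^ 12) ^ s⌉ + (M : ℤ)) < (M : ℤ) ^ 2) :
    ∃ N : ℕ, 1 ≤ N ∧ (M : ℝ) < eigenvalue N ∧ (eigenvalue N : ℝ) ≤ 68 * (M : ℝ) ^ 12 ∧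
      ∀ j m : Lattice, |len j ^ 2 - eigenvalue N| ≤ (eigenvalue N : ℝ) ^ s →
        |len (j - m) ^ 2 - eigenvalue N| ≤ (eigenvalue N : ℝ) ^ s → m ≠ 0 → (M : ℝ) < ‖m‖ := by
  set K : ℤ := ⌈(68 * (M : ℝ) ^ 12) ^ s⌉ with hK
  have hK0 : 0 ≤ K := Int.ceil_nonneg (by positivity)
  have hM2 : (2 : ℤ) ≤ M := by exact_mod_cast hM
  obtain ⟨x, y, hx, hx', hy, hy', hsep⟩ := exists_sparse_annulus (by linarith) hK0 hw
  have hM3 : (M : ℤ) ^ 3 ≤ (M : ℤ) ^ 6 := pow_le_pow_right₀ (by linarith) (by norm_num)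
  have hM1 : (M : ℤ) ≤ (M : ℤ) ^ 3 := le_self_pow₀ (by linarith) (by norm_num)
  obtain ⟨n, hn⟩ := Int.eq_ofNat_of_zero_le (show 0 ≤ x ^ 2 + y ^ 2 by positivity)
  have hj : (![x, y] : Lattice) ≠ 0 := fun h => by
    have : x = 0 := congrFun h 0
    linarith
  obtain ⟨N, hN1, hN⟩ := exists_eigenvalue_eq hj (n := n) (by simpa using hn.symm)
  have hnx : (n : ℝ) = (x : ℝ) ^ 2 + (y : ℝ) ^ 2 := by exact_mod_cast hn.symm
  -- From `x < 8M⁶` and `y < 2M³ ≤ 2M⁶`: `64 + 4 = 68`.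
  have hle : (n : ℤ) ≤ 68 * (M : ℤ) ^ 12 := by
    have e1 : x ^ 2 ≤ (8 * (M : ℤ) ^ 6) ^ 2 := pow_le_pow_left₀ (by linarith) hx'.le 2
    have e2 : y ^ 2 ≤ (2 * (M : ℤ) ^ 6) ^ 2 := pow_le_pow_left₀ (by linarith) (by linarith) 2
    rw [← hn]
    ring_nf at e1 e2 ⊢
    linarith
  have hle' : (n : ℝ) ≤ 68 * (M : ℝ) ^ 12 := by exact_mod_cast hle
  have hKle : (n : ℝ) ^ s ≤ K :=
    (Real.rpow_le_rpow (by positivity) hle' hs0.le).trans (Int.le_ceil _)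
  refine ⟨N, hN1, ?_, by rwa [hN], ?_⟩
  · rw [hN]
    have : (M : ℤ) < n := by
      rw [← hn]
      nlinarith [sq_nonneg y]
    exact_mod_cast this
  · intro j m h1 h2 hm
    rw [hN, hnx] at h1 h2
    rw [len_sq, ← hnx] at h1 h2
    by_contra! hcon
    have hcoord : ∀ i, |m i| ≤ (M : ℤ) := by
      intro i
      have := (norm_le_pi_norm m i).trans hcon
      rw [Int.norm_eq_abs] at this
      exact_mod_cast this
    have h1' := h1.trans hKle
    have h2' := h2.trans hKle
    rw [hnx] at h1' h2'
    simp only [Pi.sub_apply] at h2'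
    obtain ⟨z0, z1⟩ := hsep (j 0) (j 1) (m 0) (m 1) (hcoord 0) (hcoord 1)
      (by exact_mod_cast h1') (by exact_mod_cast h2')
    apply hm
    ext i
    fin_cases i
    · exact z0
    · exact z1

end HNSE

end

/-! ### Conclusion -/

theorem proposition3p8 (s : ℝ) (hs0 : 0 < s) (hs : s < 1 / 6) :
    ∃ c : ℝ, 0 < c ∧
      ∀ (β ρ : ℝ) (θ : ℂ → ℂ), 17 / 12 < β → β < 3 / 2 → 3 - 2 * β < s → 0 < ρ →
        HNSE.IsCutoff θ →
        ∃ F' : HNSE.H → (HNSE.H →L[ℝ] HNSE.H),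
          (∀ u, HNSE.HasGateauxDerivAt (HNSE.nonlinearity β ρ θ) (F' u) u) ∧
          ∀ Λ : ℝ, ∃ (N : ℕ) (k : ℝ), 1 ≤ N ∧ Λ < HNSE.eigenvalue N ∧
            c * (HNSE.eigenvalue N : ℝ) ^ s ≤ k ∧ k < HNSE.eigenvalue N ∧
            ∀ u, ‖HNSE.midProj k N ∘L F' u ∘L HNSE.midProj k N‖ ≤
              1 / 16 * (HNSE.eigenvalue N : ℝ) ^ (-(1 / 2) * (3 - 2 * β)) := by
  -- The half-width will be exactly `λ_N^s`, so `c = 1` serves.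
  refine ⟨1, one_pos, fun β ρ θ hβ hβ' _ hρ hθ => ?_⟩
  set ε := 2 * β - 17 / 6 with hε
  have hε0 : 0 < ε := by linarith
  obtain ⟨L, hL⟩ := HNSE.exists_isSymbol_truncSymbol hε0 hρ hθ
  refine ⟨HNSE.nonlinearityDeriv hL, HNSE.hasGateauxDerivAt_nonlinearity hβ hρ hθ hL, fun Λ => ?_⟩
  have hsum := HNSE.summable_norm_freq (r := 2 + ε) (by linarith)
  set C := 2 * L * (4 * ρ * ∑' j : HNSE.Lattice, ‖j‖ ^ (-(2 + ε))) with hC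
  obtain ⟨M, hw, htail, hM2, hMΛ⟩ := ((HNSE.eventually_window_width hs0 hs).and
    ((HNSE.eventually_tail_le (a := 1 / 2 * (3 - 2 * β)) (C := C) (by linarith)
      (by linarith)).and ((Filter.eventually_ge_atTop 2).and
        (Filter.eventually_ge_atTop ⌈Λ⌉₊)))).exists
  obtain ⟨N, hN, hlow, hup, hsep⟩ := HNSE.exists_sparse_window hs0 hM2 hw
  have hM2' : (2 : ℝ) ≤ M := by exact_mod_cast hM2
  have hpos : (0 : ℝ) < HNSE.eigenvalue N := by linarith
  refine ⟨N, (HNSE.eigenvalue N : ℝ) ^ s, hN, ?_, (one_mul _).le, ?_, fun u => ?_⟩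
  · exact lt_of_le_of_lt ((Nat.le_ceil Λ).trans (by exact_mod_cast hMΛ)) hlow
  · calc (HNSE.eigenvalue N : ℝ) ^ s < (HNSE.eigenvalue N : ℝ) ^ (1 : ℝ) :=
          Real.rpow_lt_rpow_of_exponent_lt (by linarith) (by linarith)
      _ = _ := Real.rpow_one _
  have hbound := HNSE.norm_midProj_comp_le hL ((HNSE.eigenvalue N : ℝ) ^ s) N
    (t := fun m => (M : ℝ)⁻¹ * (4 * ρ) * ‖m‖ ^ (-(2 + ε))) (hsum.mul_left _)
    (fun m => by positivity) (fun m j hj hjm => ?_) u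
  · have h := htail _ hpos hup
    rw [neg_mul]
    refine (hbound.trans_eq ?_).trans h
    rw [tsum_mul_left, hC]
    ring
  · rcases eq_or_ne m 0 with rfl | hm
    -- The difference `m = 0` always occurs but is harmless: `W(u)` has no mean, and the majorant at
    -- `0` is `0` since a nonzero real power of `0` is `0`.
    · rw [HNSE.len_zero, Real.zero_rpow (by linarith), mul_zero]
      positivity
    · have hMm := hsep j m (abs_le.2 ⟨by linarith [hj.2.1], by linarith [hj.2.2]⟩)
        (abs_le.2 ⟨by linarith [hjm.2.1], by linarith [hjm.2.2]⟩) hm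
      have hm0 : 0 < ‖m‖ := norm_pos_iff.2 hm
      -- One of the `3 + ε` powers of `|m|` is traded for `1/M`, leaving a summable weight
      -- independent of `M`.
      have e1 := HNSE.len_rpow_neg_le (r := 3 + ε) (by linarith) m
      have e2 : ‖m‖ ^ (-(3 + ε)) = ‖m‖⁻¹ * ‖m‖ ^ (-(2 + ε)) := by
        rw [← Real.rpow_neg_one, ← Real.rpow_add hm0]
        congr 1
        ring
      calc 4 * ρ * HNSE.len m ^ (-(3 + ε)) ≤ 4 * ρ * (‖m‖⁻¹ * ‖m‖ ^ (-(2 + ε))) := by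
            rw [← e2]; gcongr
        _ ≤ 4 * ρ * ((M : ℝ)⁻¹ * ‖m‖ ^ (-(2 + ε))) := by gcongr
        _ = _ := by ring
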